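/- Let $n\geq 1$, let $\mathbb K=\mathbb C(\mathsf u,\mathsf v)$ with indeterminates $\mathsf u,\mathsf v$, and let $\mathcal E_n^{\mathtt B}$ (the bt-algebra of type $\mathtt B$) be the unital associative $\mathbb K$-algebra generated by $B_1$, $T_1,\dots,T_{n-1}$, $E_1,\dots,E_{n-1}$, $F_1,\dots,F_n$ subject to the relations (for all indices for which they make sense, with $s_i$ the transposition $(i,i+1)$) $$\begin{aligned} &T_iT_j=T_jT_i,\quad E_iT_j=T_jE_i\quad(|i-j|>1),\qquad T_iT_{i+1}T_i=T_{i+1}T_iT_{i+1},\qquad T_i^2=1+(\mathsf u-\mathsf u^{-1})E_iT_i,\\ &E_i^2=E_i,\qquad E_iE_j=E_jE_i,\qquad E_iT_i=T_iE_i,\\ &E_iE_jT_i=T_iE_iE_j=E_jT_iE_j,\quad E_iT_jT_i=T_jT_iE_j\quad(|i-j|=1),\\ &B_1T_1B_1T_1=T_1B_1T_1B_1,\qquad B_1T_i=T_iB_1\ (i>1),\qquad B_1^2=1+(\mathsf v-\mathsf v^{-1})F_1B_1,\qquad B_1E_i=E_iB_1,\\ &F_j^2=F_j,\qquad B_1F_j=F_jB_1,\qquad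 F_jE_i=E_iF_j,\qquad F_jT_i=T_iF_{s_i(j)},\qquad E_iF_i=F_iF_{i+1}=E_iF_{i+1}. \end{aligned}$$ Let $V$ be a $\mathbb K$-vector space with basis $\{v_i^r : i\in\{-n,\dots,-1,1,\dots,n\},\ 0\le r\le n\}$. Define endomorphisms $\mathbf B,\mathbf F$ of $V$ and $\mathbf T,\mathbf E$ of $V\otimes V$, written on the right of their arguments, by $$(v_i^r)\mathbf B=\begin{cases}v_{-i}^r+(\mathsf v-\mathsf v^{-1})v_i^r & i<0,\ r=0,\\ v_{-i}^r&\text{otherwise,}\end{cases}\qquad (v_i^r)\mathbf F=\begin{cases}v_i^r& r=0,\\ 0&r>0,\end{cases}$$ $$(v_i^r\otimes v_j^s)\mathbf T=\begin{cases}\mathsf u\,v_j^s\otimes v_i^r& i=j,\ r=s,\\ v_j^s\otimes v_i^r+(\mathsf u-\mathsf u^{-1})v_i^r\otimes v_j^s& i>j,\ r=s,\\ v_j^s\otimes v_i^r&\text{otherwise,}\end{cases}\qquad (v_i^r\otimes v_j^s)\mathbf E=\begin{cases}v_i^r\otimes v_j^s& r=s,\\ 0&r\neq s.\end{cases}$$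 Let $\mathbf T_i,\mathbf E_i$ $(1\le i\le n-1)$ be the endomorphisms of $V^{\otimes n}$ that apply $\mathbf T$, $\mathbf E$ to the tensor factors $i,i+1$ and the identity to the others; let $\mathbf B_1$ apply $\mathbf B$ to the first factor and $\mathbf F_j$ $(1\le j\le n)$ apply $\mathbf F$ to the $j$-th factor, with the identity on the others. Then $B_1\mapsto\mathbf B_1$, $T_i\mapsto\mathbf T_i$, $E_i\mapsto\mathbf E_i$, $F_j\mapsto\mathbf F_j$ defines a representation $\Phi$ of $\mathcal E_n^{\mathtt B}$ on $V^{\otimes n}$ (the operators being composed from left to right), and $\Phi$ is faithful, i.e. injective. -/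

import Mathlib

open scoped TensorProduct

noncomputable section

namespace BTB

/-- The base field `ℂ(u, v)` of rational functions in two indeterminates. -/
abbrev K : Type := FractionRing (MvPolynomial (Fin 2) ℂ)

/-- The indeterminate `u`. -/
def uu : K := algebraMap (MvPolynomial (Fin 2) ℂ) K (MvPolynomial.X 0)

/-- The indeterminate `v`. -/
def vv : K := algebraMap (MvPolynomial (Fin 2) ℂ) K (MvPolynomial.X 1)

/-! ### The bt-algebra of type B

All indices are shifted to start from `0`: the index `i : Fin (n - 1)` of `T` and `E` stands for
`i + 1 ∈ {1, …, n - 1}`, and the index `j : Fin n` of `F` stands for `j + 1 ∈ {1, …, n}`. -/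

/-- The position of `i ∈ {1, …, n - 1}` in `{1, …, n}`. -/
def lo {n : ℕ} (i : Fin (n - 1)) : Fin n := ⟨i.val, by omega⟩

/-- The position of `i + 1`, for `i ∈ {1, …, n - 1}`, in `{1, …, n}`. -/
def hi {n : ℕ} (i : Fin (n - 1)) : Fin n := ⟨i.val + 1, by omega⟩

/-- `|i - j| > 1`. -/
def Far {n : ℕ} (i j : Fin (n - 1)) : Prop := i.val + 1 < j.val ∨ j.val + 1 < i.val

/-- `|i - j| = 1`. -/
def Near {n : ℕ} (i j : Fin (n - 1)) : Prop := i.val + 1 = j.val ∨ j.val + 1 = i.val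

/-- The generators `B₁`, `T₁, …, Tₙ₋₁`, `E₁, …, Eₙ₋₁`, `F₁, …, Fₙ`. -/
inductive Gen (n : ℕ) : Type
  | B : Gen n
  | T (i : Fin (n - 1)) : Gen n
  | E (i : Fin (n - 1)) : Gen n
  | F (j : Fin n) : Gen n

/-- The free algebra on the generators. -/
abbrev Free (n : ℕ) : Type := FreeAlgebra K (Gen n)

abbrev fB (n : ℕ) : Free n := FreeAlgebra.ι K Gen.B
abbrev fT {n : ℕ} (i : Fin (n - 1)) : Free n := FreeAlgebra.ι K (Gen.T i)
abbrev fE {n : ℕ} (i : Fin (n - 1)) : Free n := FreeAlgebra.ι K (Gen.E i)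
abbrev fF {n : ℕ} (j : Fin n) : Free n := FreeAlgebra.ι K (Gen.F j)

/-- The defining relations. -/
inductive Rel (n : ℕ) [NeZero n] : Free n → Free n → Prop
  | T_comm (i j : Fin (n - 1)) (h : Far i j) : Rel n (fT i * fT j) (fT j * fT i)
  | T_braid (i j : Fin (n - 1)) (h : i.val + 1 = j.val) :
      Rel n (fT i * fT j * fT i) (fT j * fT i * fT j)
  | T_quad (i : Fin (n - 1)) : Rel n (fT i * fT i) (1 + (uu - uu⁻¹) • (fE i * fT i))
  | E_idem (i : Fin (n - 1)) : Rel n (fE i * fE i) (fE i)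
  | E_comm (i j : Fin (n - 1)) : Rel n (fE i * fE j) (fE j * fE i)
  | ET_same (i : Fin (n - 1)) : Rel n (fE i * fT i) (fT i * fE i)
  | ET_far (i j : Fin (n - 1)) (h : Far i j) : Rel n (fE i * fT j) (fT j * fE i)
  | EET_left (i j : Fin (n - 1)) (h : Near i j) :
      Rel n (fE i * fE j * fT i) (fT i * fE i * fE j)
  | EET_right (i j : Fin (n - 1)) (h : Near i j) :
      Rel n (fT i * fE i * fE j) (fE j * fT i * fE j)
  | ETT (i j : Fin (n - 1)) (h : Near i j) :
      Rel n (fE i * fT j * fT i) (fT j * fT i * fE j)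
  | BT_braid (i : Fin (n - 1)) (h : i.val = 0) :
      Rel n (fB n * fT i * fB n * fT i) (fT i * fB n * fT i * fB n)
  | BT_comm (i : Fin (n - 1)) (h : 0 < i.val) : Rel n (fB n * fT i) (fT i * fB n)
  | B_quad : Rel n (fB n * fB n) (1 + (vv - vv⁻¹) • (fF (0 : Fin n) * fB n))
  | BE_comm (i : Fin (n - 1)) : Rel n (fB n * fE i) (fE i * fB n)
  | F_idem (j : Fin n) : Rel n (fF j * fF j) (fF j)
  | BF_comm (j : Fin n) : Rel n (fB n * fF j) (fF j * fB n)
  | FE_comm (j : Fin n) (i : Fin (n - 1)) : Rel n (fF j * fE i) (fE i * fF j)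
  | FT (j : Fin n) (i : Fin (n - 1)) :
      Rel n (fF j * fT i) (fT i * fF (Equiv.swap (lo i) (hi i) j))
  | EF_lo (i : Fin (n - 1)) : Rel n (fE i * fF (lo i)) (fF (lo i) * fF (hi i))
  | EF_hi (i : Fin (n - 1)) : Rel n (fF (lo i) * fF (hi i)) (fE i * fF (hi i))

/-- The bt-algebra of type `B`. -/
abbrev Alg (n : ℕ) [NeZero n] : Type := RingQuot (Rel n)

/-- The class in the bt-algebra of a generator. -/
def gen {n : ℕ} [NeZero n] (g : Gen n) : Alg n :=
  RingQuot.mkAlgHom K (Rel n) (FreeAlgebra.ι K g)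

/-! ### The operators -/

/-- The set `{-n, …, -1, 1, …, n}`. -/
abbrev X (n : ℕ) : Type := {i : ℤ // i ≠ 0 ∧ |i| ≤ n}

/-- The map `i ↦ -i`. -/
def X.neg {n : ℕ} (i : X n) : X n := ⟨-i.1, by simpa using i.2⟩

variable {V : Type*} [AddCommGroup V] [Module K V]

/-- The endomorphism `𝐁` of `V`; the basis vector `b (i, r)` is `v_i^r`. -/
def opB {n : ℕ} (b : Module.Basis (X n × Fin (n + 1)) K V) : Module.End K V :=
  b.constr K fun p =>
    if p.2 = 0 ∧ p.1.1 < 0 then b (p.1.neg, p.2) + (vv - vv⁻¹) • b p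
    else b (p.1.neg, p.2)

/-- The endomorphism `𝐅` of `V`. -/
def opF {n : ℕ} (b : Module.Basis (X n × Fin (n + 1)) K V) : Module.End K V :=
  b.constr K fun p => if p.2 = 0 then b p else 0

/-- The endomorphism `𝐓` of `V ⊗ V`. -/
def opT {n : ℕ} (b : Module.Basis (X n × Fin (n + 1)) K V) : Module.End K (V ⊗[K] V) :=
  (b.tensorProduct b).constr K fun p =>
    if p.1.2 = p.2.2 then
      if p.1.1.1 = p.2.1.1 then uu • (b p.2 ⊗ₜ[K] b p.1)
      else if p.1.1.1 < p.2.1.1 then b p.2 ⊗ₜ[K] b p.1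
      else b p.2 ⊗ₜ[K] b p.1 + (uu - uu⁻¹) • (b p.1 ⊗ₜ[K] b p.2)
    else b p.2 ⊗ₜ[K] b p.1

/-- The endomorphism `𝐄` of `V ⊗ V`. -/
def opE {n : ℕ} (b : Module.Basis (X n × Fin (n + 1)) K V) : Module.End K (V ⊗[K] V) :=
  (b.tensorProduct b).constr K fun p =>
    if p.1.2 = p.2.2 then b p.1 ⊗ₜ[K] b p.2 else 0

/-- The `n`-th tensor power `V^{⊗ n}`. -/
abbrev Pow (V : Type*) [AddCommGroup V] [Module K V] (n : ℕ) : Type _ :=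
  PiTensorProduct K (fun _ : Fin n => V)

/-- `1^{⊗ (j - 1)} ⊗ f ⊗ 1^{⊗ (n - j)}`. -/
def actOne {n : ℕ} (j : Fin n) (f : Module.End K V) : Module.End K (Pow V n) :=
  PiTensorProduct.map (Function.update (fun _ => LinearMap.id) j f)

theorem lo_ne_hi {n : ℕ} (i : Fin (n - 1)) : lo i ≠ hi i := by
  simp [lo, hi, Fin.ext_iff]

/-- The linear map `V ⊗ V → V^{⊗ n}` which sends `a ⊗ c` to the pure tensor obtained from
`x₁ ⊗ ⋯ ⊗ xₙ` by putting `a` and `c` in place of the factors `i` and `i + 1`. -/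
def insertTwo {n : ℕ} (i : Fin (n - 1)) (x : Fin n → V) : V ⊗[K] V →ₗ[K] Pow V n :=
  TensorProduct.lift <| LinearMap.mk₂ K
    (fun a c => PiTensorProduct.tprod K (Function.update (Function.update x (lo i) a) (hi i) c))
    (fun a a' c => by
      simp only [Function.update_comm (lo_ne_hi i), MultilinearMap.map_update_add])
    (fun k a c => by
      simp only [Function.update_comm (lo_ne_hi i), MultilinearMap.map_update_smul])
    (fun a c c' => by simp only [MultilinearMap.map_update_add])
    (fun k a c => by simp only [MultilinearMap.map_update_smul])

theorem insertTwo_tmul {n : ℕ} (i : Fin (n - 1)) (x : Fin n → V) (a c : V) :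
    insertTwo i x (a ⊗ₜ[K] c) =
      PiTensorProduct.tprod K (Function.update (Function.update x (lo i) a) (hi i) c) := rfl

theorem insertTwo_congr {n : ℕ} (i : Fin (n - 1)) (x y : Fin n → V)
    (h : ∀ k, k ≠ lo i → k ≠ hi i → x k = y k) : insertTwo i x = insertTwo i y := by
  apply TensorProduct.ext'
  intro a c
  rw [insertTwo_tmul, insertTwo_tmul]
  congr 1
  funext k
  by_cases h2 : k = hi i
  · subst h2; simp
  · by_cases h1 : k = lo i
    · subst h1; simp [h2]
    · simp [h1, h2, h k h1 h2]

theorem update_off {V : Type*} {n : ℕ} (i : Fin (n - 1)) (x : Fin n → V) (k : Fin n)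
    (h1 : k ≠ lo i) (h2 : k ≠ hi i) (a c d : V) :
    Function.update (Function.update (Function.update x k d) (lo i) a) (hi i) c =
      Function.update (Function.update (Function.update x (lo i) a) (hi i) c) k d := by
  rw [Function.update_comm h1, Function.update_comm h2]

theorem insertTwo_add {n : ℕ} (i : Fin (n - 1)) (x : Fin n → V) (k : Fin n)
    (h1 : k ≠ lo i) (h2 : k ≠ hi i) (d d' : V) :
    insertTwo i (Function.update x k (d + d')) =
      insertTwo i (Function.update x k d) + insertTwo i (Function.update x k d') := by
  apply TensorProduct.ext'
  intro a c
  simp only [LinearMap.add_apply, insertTwo_tmul, update_off i x k h1 h2,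
    MultilinearMap.map_update_add]

theorem insertTwo_smul {n : ℕ} (i : Fin (n - 1)) (x : Fin n → V) (k : Fin n)
    (h1 : k ≠ lo i) (h2 : k ≠ hi i) (t : K) (d : V) :
    insertTwo i (Function.update x k (t • d)) = t • insertTwo i (Function.update x k d) := by
  apply TensorProduct.ext'
  intro a c
  simp only [LinearMap.smul_apply, insertTwo_tmul, update_off i x k h1 h2,
    MultilinearMap.map_update_smul]

/-- `1^{⊗ (i - 1)} ⊗ f ⊗ 1^{⊗ (n - i - 1)}`: on a pure tensor, `f` is applied to the factors
`i` and `i + 1`, and the other factors stay. -/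
def actTwo {n : ℕ} (i : Fin (n - 1)) (f : Module.End K (V ⊗[K] V)) : Module.End K (Pow V n) :=
  PiTensorProduct.lift <| MultilinearMap.mk'
    (fun x : Fin n → V => insertTwo i x (f (x (lo i) ⊗ₜ[K] x (hi i))))
    (fun x k d d' => by
      by_cases h1 : k = lo i
      · subst h1
        rw [insertTwo_congr i (Function.update x (lo i) (d + d')) x (by simp +contextual),
          insertTwo_congr i (Function.update x (lo i) d) x (by simp +contextual),
          insertTwo_congr i (Function.update x (lo i) d') x (by simp +contextual)]
        simp [(lo_ne_hi i).symm, TensorProduct.add_tmul]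
      · by_cases h2 : k = hi i
        · subst h2
          rw [insertTwo_congr i (Function.update x (hi i) (d + d')) x (by simp +contextual),
            insertTwo_congr i (Function.update x (hi i) d) x (by simp +contextual),
            insertTwo_congr i (Function.update x (hi i) d') x (by simp +contextual)]
          simp [lo_ne_hi i, TensorProduct.tmul_add]
        · rw [insertTwo_add i x k h1 h2]
          simp [Ne.symm h1, Ne.symm h2])
    (fun x k t d => by
      by_cases h1 : k = lo i
      · subst h1
        rw [insertTwo_congr i (Function.update x (lo i) (t • d)) x (by simp +contextual),
          insertTwo_congr i (Function.update x (lo i) d) x (by simp +contextual)]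
        simp [(lo_ne_hi i).symm, ← TensorProduct.smul_tmul']
      · by_cases h2 : k = hi i
        · subst h2
          rw [insertTwo_congr i (Function.update x (hi i) (t • d)) x (by simp +contextual),
            insertTwo_congr i (Function.update x (hi i) d) x (by simp +contextual)]
          simp [lo_ne_hi i, TensorProduct.tmul_smul]
        · rw [insertTwo_smul i x k h1 h2]
          simp [Ne.symm h1, Ne.symm h2])

theorem actTwo_tprod {n : ℕ} (i : Fin (n - 1)) (f : Module.End K (V ⊗[K] V)) (x : Fin n → V) :
    actTwo i f (PiTensorProduct.tprod K x) = insertTwo i x (f (x (lo i) ⊗ₜ[K] x (hi i))) := by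
  simp [actTwo]

/-- The operator on `V^{⊗ n}` which corresponds to a generator. -/
def opGen {n : ℕ} [NeZero n] (b : Module.Basis (X n × Fin (n + 1)) K V) :
    Gen n → Module.End K (Pow V n)
  | .B => actOne 0 (opB b)
  | .T i => actTwo i (opT b)
  | .E i => actTwo i (opE b)
  | .F j => actOne j (opF b)

end BTB

end

/-! The relations are checked on pure tensors of basis vectors. There the operators of the Eᵢ and Fⱼ
are diagonal, with eigenvalues depending only on the colours (the upper indices), so most relations
become identities between functions of colours. The two braid relations are the Yang–Baxter equation
(`yangBaxter`) and a reflection equation (`reflection`).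

Faithfulness needs no basis of the algebra. A signed permutation w is encoded by an arrangement of
indices, and T_w is the product of generators along a reduced word, independent of the word
(`redProd_eq`). Conjugating the Eᵢ gives commuting idempotents E_{i,j}, which the T_w permute
together with the Fⱼ.

Let a ≠ 0 lie in the kernel. Some idempotent e, polynomial in the E_{i,j} and Fⱼ, satisfies e a ≠ 0
and is fixed or killed by each of them (`exists_separating`). The pairs whose E_{i,j} fixes e form
an equivalence relation, with one distinguished, possibly empty, class given by the Fⱼ, hence a
colouring r of the labels by n + 1 colours (`exists_colouring`). By the quadratic relations e a is a
combination of the e T_w (`mul_mem_wordSpan`).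

Apply e a to v_1^{r_1} ⊗ ⋯ ⊗ v_n^{r_n}. The idempotents act on this vector by the same character as
on e, so e fixes it. Each T_w sends it to a basis tensor of its own, since the diagonal terms of 𝐓
and 𝐁 vanish at every step of a reduced word. As a acts by zero, all coefficients vanish and e a =
0, a contradiction (`injective_of_vec`). -/

noncomputable section

namespace BTB

/-! ### The operators on pure tensors of basis vectors -/

section

variable {V : Type*} [AddCommGroup V] [Module K V] {n : ℕ}

/-- The pure tensor of basis vectors with index `x`. -/
def basisTensor (b : Module.Basis (X n × Fin (n + 1)) K V) (x : Fin n → X n × Fin (n + 1)) :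
    Pow V n :=
  PiTensorProduct.tprod K fun k => b (x k)

theorem piTensorProduct_eq_basisTensor (b : Module.Basis (X n × Fin (n + 1)) K V)
    (x : Fin n → X n × Fin (n + 1)) :
    Basis.piTensorProduct (fun _ : Fin n => b) x = basisTensor b x :=
  Basis.piTensorProduct_apply _ x

section Coefficients

variable {R : Type*} [CommRing R]

/-- The coefficient of the swapped tensor in the action of `𝐓`. -/
def swapCoeff (u : R) (p q : X n × Fin (n + 1)) : R := if p = q then u else 1

/-- The diagonal coefficient in the action of `𝐓`. -/
def diagCoeff (c : R) (p q : X n × Fin (n + 1)) : R := if p.2 = q.2 ∧ q.1.1 < p.1.1 then c else 0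

/-- The diagonal coefficient in the action of `𝐁`. -/
def signCoeff (d : R) (p : X n × Fin (n + 1)) : R := if p.2 = 0 ∧ p.1.1 < 0 then d else 0

end Coefficients

/-- The sign change of an index. -/
def flip (p : X n × Fin (n + 1)) : X n × Fin (n + 1) := (p.1.neg, p.2)

theorem opT_apply (b : Module.Basis (X n × Fin (n + 1)) K V) (p q : X n × Fin (n + 1)) :
    opT b (b p ⊗ₜ b q) = swapCoeff uu p q • (b q ⊗ₜ b p) +
      diagCoeff (uu - uu⁻¹) p q • (b p ⊗ₜ[K] b q) := by
  have : b p ⊗ₜ[K] b q = (b.tensorProduct b) (p, q) := by simp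
  rw [opT, this, Module.Basis.constr_basis]
  obtain ⟨⟨i, hi⟩, r⟩ := p
  obtain ⟨⟨j, hj⟩, s⟩ := q
  simp only [swapCoeff, diagCoeff, Prod.mk.injEq, Subtype.mk.injEq,
    Module.Basis.tensorProduct_apply]
  by_cases hrs : r = s
  · rcases lt_trichotomy i j with h | h | h
    · simp [hrs, h, h.ne, h.not_gt]
    · simp [hrs, h]
    · simp [hrs, h, h.ne', h.not_gt]
  · simp [hrs]

theorem opE_apply (b : Module.Basis (X n × Fin (n + 1)) K V) (p q : X n × Fin (n + 1)) :
    opE b (b p ⊗ₜ b q) = (if p.2 = q.2 then (1 : K) else 0) • (b p ⊗ₜ[K] b q) := by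
  have : b p ⊗ₜ[K] b q = (b.tensorProduct b) (p, q) := by simp
  rw [opE, this, Module.Basis.constr_basis]
  simp

theorem update_swap {α : Type*} (i : Fin (n - 1)) (x : Fin n → α) :
    Function.update (Function.update x (lo i) (x (hi i))) (hi i) (x (lo i)) =
      x ∘ Equiv.swap (lo i) (hi i) := by
  funext k
  simp only [Function.update_apply, Function.comp_apply, Equiv.swap_apply_def]
  have := lo_ne_hi i
  split_ifs <;> simp_all

theorem insertTwo_basis (b : Module.Basis (X n × Fin (n + 1)) K V) (i : Fin (n - 1))
    (x : Fin n → X n × Fin (n + 1)) (p q : X n × Fin (n + 1)) :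
    insertTwo i (fun k => b (x k)) (b p ⊗ₜ b q) =
      basisTensor b (Function.update (Function.update x (lo i) p) (hi i) q) := by
  rw [insertTwo_tmul, basisTensor]
  congr 1
  funext k
  simp only [Function.update_apply]
  split_ifs <;> rfl

theorem opGen_T (b : Module.Basis (X n × Fin (n + 1)) K V) [NeZero n] (i : Fin (n - 1))
    (x : Fin n → X n × Fin (n + 1)) :
    opGen b (.T i) (basisTensor b x) =
      swapCoeff uu (x (lo i)) (x (hi i)) • basisTensor b (x ∘ Equiv.swap (lo i) (hi i)) +
        diagCoeff (uu - uu⁻¹) (x (lo i)) (x (hi i)) • basisTensor b x := by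
  rw [opGen, basisTensor, actTwo_tprod, opT_apply, map_add, map_smul, map_smul,
    insertTwo_basis, insertTwo_basis, update_swap]
  simp [basisTensor]

theorem opGen_E (b : Module.Basis (X n × Fin (n + 1)) K V) [NeZero n] (i : Fin (n - 1))
    (x : Fin n → X n × Fin (n + 1)) :
    opGen b (.E i) (basisTensor b x) =
      (if (x (lo i)).2 = (x (hi i)).2 then (1 : K) else 0) • basisTensor b x := by
  rw [opGen, basisTensor, actTwo_tprod, opE_apply, map_smul, insertTwo_basis]
  simp [basisTensor]

theorem opGen_F (b : Module.Basis (X n × Fin (n + 1)) K V) [NeZero n] (j : Fin n)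
    (x : Fin n → X n × Fin (n + 1)) :
    opGen b (.F j) (basisTensor b x) = (if (x j).2 = 0 then (1 : K) else 0) • basisTensor b x := by
  rw [opGen, basisTensor, actOne, PiTensorProduct.map_tprod]
  have : (fun k => (Function.update (fun _ => LinearMap.id) j (opF b) k) (b (x k))) =
      Function.update (fun k => b (x k)) j ((if (x j).2 = 0 then (1 : K) else 0) • b (x j)) := by
    funext k
    by_cases h : k = j
    · subst h
      simp [opF, Module.Basis.constr_basis]
    · simp [h]
  rw [this, MultilinearMap.map_update_smul]
  simp

theorem opGen_B (b : Module.Basis (X n × Fin (n + 1)) K V) [NeZero n]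
    (x : Fin n → X n × Fin (n + 1)) :
    opGen b .B (basisTensor b x) =
      basisTensor b (Function.update x 0 (flip (x 0))) +
        signCoeff (vv - vv⁻¹) (x 0) • basisTensor b x := by
  rw [opGen, basisTensor, actOne, PiTensorProduct.map_tprod]
  have : (fun k => (Function.update (fun _ => LinearMap.id) (0 : Fin n) (opB b) k) (b (x k))) =
      Function.update (fun k => b (x k)) 0
        (b (flip (x 0)) + signCoeff (vv - vv⁻¹) (x 0) • b (x 0)) := by
    funext k
    by_cases h : k = 0
    · subst h
      simp only [Function.update_self, opB, Module.Basis.constr_basis, signCoeff, flip]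
      split_ifs <;> simp
    · simp [h]
  rw [this, MultilinearMap.map_update_add, MultilinearMap.map_update_smul]
  have : Function.update (fun k => b (x k)) 0 (b (flip (x 0))) =
      fun k => b (Function.update x 0 (flip (x 0)) k) := by
    funext k
    simp only [Function.update_apply]
    split_ifs <;> rfl
  rw [this]
  simp [basisTensor]

end

/-! ### Idempotents indexed by pairs -/

section

section Conjugates

variable {A : Type*} [Ring A] {m : ℕ} {t : ℕ → Aˣ} {e : ℕ → A}

/-- The relations between the invertible elements `t i` and the elements `e i`, `i < m`, which make
the conjugates of the `e i` under the `t i` depend only on a pair of indices. -/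
structure IsTied (m : ℕ) (t : ℕ → Aˣ) (e : ℕ → A) : Prop where
  tt_far : ∀ i j, i + 1 < j → j < m → Commute (t i : A) (t j)
  braid : ∀ i, i + 1 < m → (t i * t (i + 1) * t i : A) = t (i + 1) * t i * t (i + 1)
  et_same : ∀ i, i < m → Commute (t i : A) (e i)
  et_far : ∀ i j, i + 1 < j → j < m → Commute (t j : A) (e i)
  et_far' : ∀ i j, i + 1 < j → j < m → Commute (t i : A) (e j)
  et_sq : ∀ i, i + 1 < m → Commute (t (i + 1) * t (i + 1) : A) (e i)
  ett : ∀ i, i + 1 < m → e i * t (i + 1) * t i = t (i + 1) * t i * e (i + 1)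
  ee_comm : ∀ i j, i < m → j < m → Commute (e i) (e j)
  ete : ∀ i, i + 1 < m → e i * t (i + 1) * e i = e i * e (i + 1) * t (i + 1)

/-- The idempotent which ties `i` and `i + d + 1`. -/
def tieAux (t : ℕ → Aˣ) (e : ℕ → A) (i : ℕ) : ℕ → A
  | 0 => e i
  | d + 1 => ↑(t (i + d + 1))⁻¹ * tieAux t e i d * t (i + d + 1)

/-- The idempotent which ties `i` and `j`. -/
def tie (t : ℕ → Aˣ) (e : ℕ → A) (i j : ℕ) : A :=
  -- The value `1` on the diagonal keeps the identities between ties valid when indices coincide.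
  if i < j then tieAux t e i (j - i - 1) else if j < i then tieAux t e j (i - j - 1) else 1

theorem tie_self (i : ℕ) : tie t e i i = 1 := by simp [tie]

theorem tie_symm (i j : ℕ) : tie t e i j = tie t e j i := by
  unfold tie
  rcases lt_trichotomy i j with h | h | h
  · simp [h, h.not_gt]
  · simp [h]
  · simp [h, h.not_gt]

theorem commute_conj {a x : A} {s : Aˣ} (h : Commute a x) (hs : Commute a (s : A)) :
    Commute a (↑s⁻¹ * x * s) :=
  (hs.units_inv_right.mul_right h).mul_right hs

namespace IsTied

variable (H : IsTied m t e)
include H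

theorem commute_tieAux_of_lt (i d k : ℕ) (h : i + d + 1 < k) (hk : k < m) :
    Commute (t k : A) (tieAux t e i d) := by
  induction d with
  | zero => exact H.et_far i k (by omega) hk
  | succ d ih =>
    exact commute_conj (ih (by omega)) (H.tt_far (i + d + 1) k (by omega) hk).symm

theorem commute_tieAux_of_gt (i d k : ℕ) (h : k + 1 < i) (hd : i + d < m) :
    Commute (t k : A) (tieAux t e i d) := by
  induction d with
  | zero => exact H.et_far' k i h (by omega)
  | succ d ih =>
    exact commute_conj (ih (by omega)) (H.tt_far k (i + d + 1) (by omega) (by omega))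

omit H in
theorem mul_tieAux_succ (i d : ℕ) :
    (t (i + d + 1) : A) * tieAux t e i (d + 1) = tieAux t e i d * t (i + d + 1) := by
  simp [tieAux, mul_assoc]

omit H in
-- The braid relation says r s r⁻¹ = s⁻¹ r s; square both sides.
theorem braid_sq {r s : Aˣ} (h : (r * s * r : A) = s * r * s) :
    (r * (s * s) : A) * ↑r⁻¹ = ↑s⁻¹ * (r * r) * s := by
  have h' : r * s * r = s * r * s := Units.ext (by push_cast; exact h)
  have : r * (s * s) * r⁻¹ = s⁻¹ * (r * r) * s := by
    have h1 : r * s * r⁻¹ = s⁻¹ * r * s := by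
      rw [mul_inv_eq_iff_eq_mul, mul_assoc, mul_assoc, eq_inv_mul_iff_mul_eq, ← mul_assoc,
        ← mul_assoc, ← h']
    calc r * (s * s) * r⁻¹ = (r * s * r⁻¹) * (r * s * r⁻¹) := by group
      _ = _ := by rw [h1]; group
  have := congrArg Units.val this
  push_cast at this
  exact this

omit H in
-- Conjugated by r, the claim is that r s² r⁻¹ commutes with x. By `braid_sq` this element is s⁻¹ r²
-- s, a product of elements commuting with x.
theorem commute_sq_conj {r s : Aˣ} {x : A} (h : (r * s * r : A) = s * r * s)
    (hs : Commute (s : A) x) (hr : Commute (r * r : A) x) :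
    Commute (s * s : A) (↑r⁻¹ * x * r) := by
  have h1 : Commute ((r * (s * s) : A) * ↑r⁻¹) x := by
    rw [braid_sq h]
    exact (hs.units_inv_left.mul_left hr).mul_left hs
  have h2 := h1.eq
  change (s * s : A) * (↑r⁻¹ * x * r) = (↑r⁻¹ * x * r) * (s * s)
  calc (s * s : A) * (↑r⁻¹ * x * r) = ↑r⁻¹ * ((r * (s * s) : A) * ↑r⁻¹ * x) * r := by
        simp [mul_assoc]
    _ = _ := by rw [h2]; simp [mul_assoc]

theorem commute_sq_tieAux_hi (i d : ℕ) (h : i + d + 1 < m) :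
    Commute (t (i + d + 1) * t (i + d + 1) : A) (tieAux t e i d) := by
  induction d with
  | zero => exact H.et_sq i h
  | succ d ih =>
    exact commute_sq_conj (H.braid (i + d + 1) h)
      (H.commute_tieAux_of_lt i d _ (by omega) (by omega)) (ih (by omega))

/-- The definition conjugates with the inverse on the left. Since the square commutes with the
idempotent, conjugating the other way gives the same element. -/
theorem mul_tieAux (i d : ℕ) (h : i + d + 1 < m) :
    (t (i + d + 1) : A) * tieAux t e i d = tieAux t e i (d + 1) * t (i + d + 1) := by
  have := (H.commute_sq_tieAux_hi i d h).eq
  rw [tieAux, mul_assoc, mul_assoc, ← this]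
  simp [← mul_assoc]

omit H in
-- Here r s⁻¹ r⁻¹ = s⁻¹ r⁻¹ s: on entering the double conjugate r turns into s, passes x, and leaves
-- as r.
theorem commute_conj_conj {r s : Aˣ} {x : A} (h : (r * s * r : A) = s * r * s)
    (hs : Commute (s : A) x) : Commute (r : A) (↑s⁻¹ * (↑r⁻¹ * x * r) * s) := by
  have h' : r * s * r = s * r * s := Units.ext (by push_cast; exact h)
  have h1 : r * s⁻¹ * r⁻¹ = s⁻¹ * r⁻¹ * s := by
    rw [mul_inv_eq_iff_eq_mul, mul_inv_eq_iff_eq_mul]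
    have : s⁻¹ * r⁻¹ * s * r * s = s⁻¹ * r⁻¹ * (s * r * s) := by group
    rw [this, ← h']
    group
  have h2 := congrArg Units.val h1
  push_cast at h2
  have hs' := hs.eq
  calc (r : A) * (↑s⁻¹ * (↑r⁻¹ * x * r) * s) = (r * ↑s⁻¹ * ↑r⁻¹) * x * r * s := by
        simp only [mul_assoc]
    _ = ↑s⁻¹ * ↑r⁻¹ * (x * s) * r * s := by rw [h2, ← hs']; simp only [mul_assoc]
    _ = ↑s⁻¹ * ↑r⁻¹ * x * (s * r * s) := by simp only [mul_assoc]
    _ = _ := by rw [← h]; simp only [mul_assoc]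

theorem commute_tieAux_of_between (i d k : ℕ) (h1 : i < k) (h2 : k + 1 < i + d + 1)
    (h : i + d < m) : Commute (t k : A) (tieAux t e i d) := by
  induction d with
  | zero => omega
  | succ d ih =>
    rcases Nat.lt_or_ge (k + 1) (i + d + 1) with h3 | h3
    · exact commute_conj (ih h3 (by omega)) (H.tt_far k (i + d + 1) (by omega) (by omega))
    · obtain ⟨d, rfl⟩ : ∃ d', d = d' + 1 := ⟨d - 1, by omega⟩
      obtain rfl : k = i + d + 1 := by omega
      exact commute_conj_conj (H.braid (i + d + 1) h)
        (H.commute_tieAux_of_lt i d _ (by omega) (by omega))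

/-- The shortest case is the relation `ett`; all further conjugations are by elements that commute
with `t i`. -/
theorem mul_tieAux_lo_succ (i d : ℕ) (h : i + d + 1 < m) :
    (t i : A) * tieAux t e (i + 1) d = tieAux t e i (d + 1) * t i := by
  induction d with
  | zero =>
    have := H.ett i h
    simp only [tieAux, add_zero]
    rw [mul_assoc, mul_assoc, ← mul_assoc (e i), this]
    simp [← mul_assoc]
  | succ d ih =>
    have hc := H.tt_far i (i + d + 2) (by omega) (by omega)
    rw [tieAux, tieAux, show i + 1 + d + 1 = i + d + 2 by ring,
      show i + (d + 1) + 1 = i + d + 2 by ring, mul_assoc _ _ (t i : A), ← hc.eq]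
    have := hc.units_inv_right.eq
    rw [← mul_assoc, ← mul_assoc, this, mul_assoc _ _ (tieAux t e (i + 1) d), ih (by omega)]
    simp only [mul_assoc]

theorem commute_sq_tieAux_lo (i d : ℕ) (h : i + d + 1 < m) :
    Commute (t i * t i : A) (tieAux t e i (d + 1)) := by
  induction d with
  | zero => exact commute_sq_conj (H.braid i h).symm (H.et_same i (by omega)) (H.et_sq i h)
  | succ d ih =>
    have hc := H.tt_far i (i + d + 2) (by omega) (by omega)
    exact commute_conj (ih (by omega)) (hc.mul_left hc)

theorem mul_tieAux_lo (i d : ℕ) (h : i + d + 1 < m) :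
    (t i : A) * tieAux t e i (d + 1) = tieAux t e (i + 1) d * t i := by
  have h1 := H.mul_tieAux_lo_succ i d h
  have h2 := (H.commute_sq_tieAux_lo i d h).eq
  rw [← (t i).mul_right_inj, ← mul_assoc, h2, ← mul_assoc, ← mul_assoc, h1]

/-- If neither or both of `k`, `k + 1` are ends of the pair, `t k` commutes with the idempotent;
otherwise one end moves by one step, to the left or to the right. -/
theorem mul_tie_of_lt (i j k : ℕ) (hk : k < m) (hij : i < j) (hj : j ≤ m) :
    (t k : A) * tie t e (Equiv.swap k (k + 1) i) (Equiv.swap k (k + 1) j) =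
      tie t e i j * t k := by
  obtain ⟨d, rfl⟩ : ∃ d, j = i + d + 1 := ⟨j - i - 1, by omega⟩
  have key : ∀ i d, tie t e i (i + d + 1) = tieAux t e i d := by
    intro i d
    rw [tie, if_pos (by omega)]
    congr 1
    omega
  rw [key]
  rcases lt_trichotomy (k + 1) i with h | h | h
  · rw [Equiv.swap_apply_of_ne_of_ne (by omega) (by omega),
      Equiv.swap_apply_of_ne_of_ne (by omega) (by omega), key]
    exact H.commute_tieAux_of_gt i d k h (by omega)
  · subst h
    rw [Equiv.swap_apply_right, Equiv.swap_apply_of_ne_of_ne (by omega) (by omega),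
      show k + 1 + d + 1 = k + (d + 1) + 1 by ring, key]
    exact H.mul_tieAux_lo k d (by omega)
  rcases lt_trichotomy k (i + d + 1) with h' | h' | h'
  · rcases eq_or_ne k i with rfl | hki
    · rw [Equiv.swap_apply_left]
      rcases d with _ | d
      · rw [add_zero, Equiv.swap_apply_right, tie_symm]
        exact (congrArg _ (key k 0)).trans (H.et_same k hk)
      · rw [Equiv.swap_apply_of_ne_of_ne (by omega) (by omega),
          show k + (d + 1) + 1 = k + 1 + d + 1 by ring, key]
        exact H.mul_tieAux_lo_succ k d (by omega)
    · rw [Equiv.swap_apply_of_ne_of_ne (a := k) (x := i) (by omega) (by omega)]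
      rcases eq_or_ne k (i + d) with rfl | hkd
      · obtain ⟨d, rfl⟩ : ∃ d', d = d' + 1 := ⟨d - 1, by omega⟩
        rw [Equiv.swap_apply_right, ← add_assoc, key]
        exact H.mul_tieAux i d hk
      · rw [Equiv.swap_apply_of_ne_of_ne (by omega) (by omega), key]
        exact H.commute_tieAux_of_between i d k (by omega) (by omega) (by omega)
  · subst h'
    rw [Equiv.swap_apply_left, Equiv.swap_apply_of_ne_of_ne (by omega) (by omega),
      show i + d + 1 + 1 = i + (d + 1) + 1 by ring, key]
    exact mul_tieAux_succ i d
  · rw [Equiv.swap_apply_of_ne_of_ne (by omega) (by omega),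
      Equiv.swap_apply_of_ne_of_ne (by omega) (by omega), key]
    exact H.commute_tieAux_of_lt i d k h' hk

theorem mul_tie (i j k : ℕ) (hk : k < m) (hi : i ≤ m) (hj : j ≤ m) :
    (t k : A) * tie t e (Equiv.swap k (k + 1) i) (Equiv.swap k (k + 1) j) =
      tie t e i j * t k := by
  rcases lt_trichotomy i j with h | rfl | h
  · exact H.mul_tie_of_lt i j k hk h hj
  · simp [tie_self]
  · rw [tie_symm, tie_symm i]
    exact H.mul_tie_of_lt j i k hk h hi

omit H in
-- The conjugations that define the ties never use `t 0`. This is why B₁, which need not commute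
-- with T₁, still commutes with all ties.
theorem commute_tie (b : A) (h : ∀ i, i < m → Commute b (e i))
    (h' : ∀ i, i + 1 < m → Commute b (t (i + 1) : A)) (i j : ℕ) (hi : i ≤ m) (hj : j ≤ m) :
    Commute b (tie t e i j) := by
  have key : ∀ i d, i + d < m → Commute b (tieAux t e i d) := by
    intro i d hd
    induction d with
    | zero => exact h i hd
    | succ d ih => exact commute_conj (ih (by omega)) (h' (i + d) hd)
  unfold tie
  split_ifs with h1 h2
  · exact key _ _ (by omega)
  · exact key _ _ (by omega)
  · exact Commute.one_right b

theorem conj_conj_eq (i : ℕ) (h : i + 1 < m) :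
    (t i : A) * e (i + 1) = tieAux t e i 1 * t i ∧
      (t (i + 1) : A) * e i = tieAux t e i 1 * t (i + 1) :=
  ⟨H.mul_tieAux_lo_succ i 0 h, H.mul_tieAux i 0 h⟩

/-- Transitivity of ties for three neighbours: in `ete`, move `t (i + 1)` to the right and cancel
it. -/
theorem mul_tieAux_one (i : ℕ) (h : i + 1 < m) : e i * tieAux t e i 1 = e i * e (i + 1) := by
  have h1 := (H.conj_conj_eq i h).2
  have h2 := H.ete i h
  rwa [mul_assoc, h1, ← mul_assoc, Units.mul_left_inj] at h2

/-- The definition conjugates `e 0` by `t 1`, which is not assumed to commute with `e 0`. The same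
element is also `e 1` conjugated by `t 0`, and there every factor commutes with `e 0`. -/
theorem commute_zero_one (h : 1 < m) : Commute (e 0) (tieAux t e 0 1) := by
  have h1 := (H.conj_conj_eq 0 h).1
  have h2 : tieAux t e 0 1 = t 0 * e 1 * ↑(t 0)⁻¹ := by
    rw [h1]
    simp [mul_assoc]
  rw [h2]
  have h3 := (H.et_same 0 (by omega)).symm
  exact (h3.mul_right (H.ee_comm 0 1 (by omega) h)).mul_right h3.units_inv_right

theorem commute_zero_tie (i j : ℕ) (hi : i ≤ m) (hj : j ≤ m) : Commute (e 0) (tie t e i j) := by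
  have key : ∀ i d, i + d < m → Commute (e 0) (tieAux t e i d) := by
    intro i d hd
    induction d with
    | zero => exact H.ee_comm 0 i (by omega) hd
    | succ d ih =>
      rcases Nat.eq_zero_or_pos (i + d) with h0 | h0
      · obtain ⟨rfl, rfl⟩ : i = 0 ∧ d = 0 := by omega
        exact H.commute_zero_one hd
      · exact commute_conj (ih (by omega)) (H.et_far 0 (i + d + 1) (by omega) hd).symm
  unfold tie
  split_ifs with h1 h2
  · exact key _ _ (by omega)
  · exact key _ _ (by omega)
  · exact Commute.one_right _

/-- Induction on `j`: each step conjugates both ties by the same `t`, which commutes with `e 0`. -/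
theorem zero_mul_tie (j : ℕ) (hj : j ≤ m) (h : 2 ≤ j) :
    e 0 * tie t e 1 j = e 0 * tie t e 0 j := by
  obtain ⟨d, rfl⟩ : ∃ d, j = d + 2 := ⟨j - 2, by omega⟩
  have h0 : tie t e 1 (d + 2) = tieAux t e 1 d := by simp [tie]
  have h1 : tie t e 0 (d + 2) = tieAux t e 0 (d + 1) := by simp [tie]
  rw [h0, h1]
  clear h0 h1 h
  induction d with
  | zero => exact (H.mul_tieAux_one 0 (by omega)).symm
  | succ d ih =>
    have hc : Commute (e 0) ↑(t (d + 2))⁻¹ :=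
      (H.et_far 0 (d + 2) (by omega) (by omega)).symm.units_inv_right
    rw [tieAux, tieAux, show 1 + d + 1 = d + 2 by ring, show 0 + (d + 1) + 1 = d + 2 by ring,
      ← mul_assoc, ← mul_assoc, hc.eq, ← mul_assoc, ← mul_assoc, hc.eq,
      mul_assoc _ (e 0), mul_assoc _ (e 0), ih (by omega)]

end IsTied
end Conjugates

end

section

variable {n : ℕ}

/-! ### Signed arrangements and reduced words -/

theorem X.ne_zero (x : X n) : x.1 ≠ 0 := x.2.1

theorem X.le (x : X n) : x.1 ≤ n := (abs_le.1 x.2.2).2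

@[simp] theorem X.neg_neg (x : X n) : x.neg.neg = x := Subtype.ext (by simp [X.neg])

@[simp] theorem X.neg_val (x : X n) : x.neg.1 = -x.1 := rfl

/-- The label of an index, `|x| - 1`. -/
def X.label (x : X n) : Fin n :=
  ⟨x.1.natAbs - 1, by have := abs_le.1 x.2.2; have := x.2.1; omega⟩

@[simp] theorem X.label_neg (x : X n) : x.neg.label = x.label := by
  simp [X.label]

/-- The positive index with a given label. -/
def X.pos (i : Fin n) : X n := ⟨i.val + 1, by omega, by rw [abs_le]; omega⟩

@[simp] theorem X.label_pos (i : Fin n) : (X.pos i).label = i := by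
  apply Fin.ext
  simp only [X.label, X.pos]
  omega

theorem X.pos_label (x : X n) (h : 0 < x.1) : X.pos x.label = x := by
  apply Subtype.ext
  simp only [X.label, X.pos]
  omega

variable [NeZero n]

/-- The action of a Coxeter generator on arrangements of indices: `none` changes the first sign and
`some i` exchanges two neighbours. -/
def move (s : Option (Fin (n - 1))) (f : Fin n → X n) : Fin n → X n :=
  match s with
  | none => Function.update f 0 (f 0).neg
  | some i => f ∘ Equiv.swap (lo i) (hi i)

/-- The Coxeter generator `s` is a descent of the arrangement `f`. -/
def Descent (s : Option (Fin (n - 1))) (f : Fin n → X n) : Prop :=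
  match s with
  | none => (f 0).1 < 0
  | some i => (f (hi i)).1 < (f (lo i)).1

theorem move_move (s : Option (Fin (n - 1))) (f : Fin n → X n) : move s (move s f) = f := by
  cases s with
  | none => simp [move]
  | some i =>
    funext k
    simp [move]

theorem label_move_some (i : Fin (n - 1)) (f : Fin n → X n) (k : Fin n) :
    (move (some i) f k).label = (f (Equiv.swap (lo i) (hi i) k)).label := rfl

theorem label_move_none (f : Fin n → X n) (k : Fin n) : (move none f k).label = (f k).label := by
  rcases eq_or_ne k 0 with rfl | h
  · simp [move]
  · simp [move, h]

/-- A measure of the distance of an arrangement from the increasing one. -/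
def height (f : Fin n → X n) : ℕ := ∑ k : Fin n, (k.val + 1) * ((n : ℤ) - (f k).1).toNat

/-- A descent either enlarges the entry in position 0 or moves the larger of two neighbours to the
place of larger weight; both lower the weighted sum of the `n - f k`. -/
theorem height_move_lt (s : Option (Fin (n - 1))) (f : Fin n → X n) (h : Descent s f) :
    height (move s f) < height f := by
  cases s with
  | none =>
    apply Finset.sum_lt_sum
    · intro k _
      rcases eq_or_ne k 0 with rfl | hk
      · simp only [Descent] at h
        simp only [move, Function.update_self, X.neg_val]
        gcongr
        omega
      · simp [move, hk]
    · refine ⟨0, Finset.mem_univ _, ?_⟩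
      simp only [Descent] at h
      simp only [move, Function.update_self, X.neg_val]
      have := (f 0).neg.le
      rw [X.neg_val] at this
      gcongr
      omega
  | some i =>
    simp only [Descent] at h
    have h1 : height (move (some i) f) =
        ∑ k : Fin n, ((Equiv.swap (lo i) (hi i) k).val + 1) * ((n : ℤ) - (f k).1).toNat := by
      rw [height, ← Equiv.sum_comp (Equiv.swap (lo i) (hi i))]
      simp [move]
    rw [h1, height, ← Finset.add_sum_erase _ _ (Finset.mem_univ (lo i)),
      ← Finset.add_sum_erase Finset.univ (fun k : Fin n => (k.val + 1) * _)
        (Finset.mem_univ (lo i)),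
      ← Finset.add_sum_erase _ _ (show hi i ∈ Finset.univ.erase (lo i) by
        simp [(lo_ne_hi i).symm]),
      ← Finset.add_sum_erase (Finset.univ.erase (lo i)) (fun k : Fin n => (k.val + 1) * _)
        (show hi i ∈ Finset.univ.erase (lo i) by simp [(lo_ne_hi i).symm])]
    have h2 : ∑ k ∈ (Finset.univ.erase (lo i)).erase (hi i),
        ((Equiv.swap (lo i) (hi i) k).val + 1) * ((n : ℤ) - (f k).1).toNat =
        ∑ k ∈ (Finset.univ.erase (lo i)).erase (hi i), (k.val + 1) * ((n : ℤ) - (f k).1).toNat := by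
      apply Finset.sum_congr rfl
      intro k hk
      simp only [Finset.mem_erase] at hk
      rw [Equiv.swap_apply_of_ne_of_ne hk.2.1 hk.1]
    rw [h2]
    have h3 : ((n : ℤ) - (f (lo i)).1).toNat < ((n : ℤ) - (f (hi i)).1).toNat := by
      have := (f (lo i)).le
      omega
    simp only [Equiv.swap_apply_left, Equiv.swap_apply_right]
    simp only [lo, hi] at h3 ⊢
    nlinarith

open Classical in
/-- The product of the generators along a chain of descents. -/
def redProd {A : Type*} [Monoid A] (g : Option (Fin (n - 1)) → A) (f : Fin n → X n) : A :=
  if h : ∃ s, Descent s f then redProd g (move h.choose f) * g h.choose else 1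
termination_by height f
decreasing_by exact height_move_lt _ _ h.choose_spec

/-- The braid relations of type `B`. -/
structure IsBraided {A : Type*} [Monoid A] (g : Option (Fin (n - 1)) → A) : Prop where
  far : ∀ i j, Far i j → g (some i) * g (some j) = g (some j) * g (some i)
  braid : ∀ i j : Fin (n - 1), i.val + 1 = j.val →
    g (some i) * g (some j) * g (some i) = g (some j) * g (some i) * g (some j)
  sign : ∀ i : Fin (n - 1), i.val = 0 →
    g none * g (some i) * g none * g (some i) = g (some i) * g none * g (some i) * g none
  sign_far : ∀ i : Fin (n - 1), 0 < i.val → g none * g (some i) = g (some i) * g none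

variable {A : Type*} [Monoid A] {g : Option (Fin (n - 1)) → A}

theorem redProd_of_not (f : Fin n → X n) (h : ¬ ∃ s, Descent s f) : redProd g f = 1 := by
  rw [redProd, dif_neg h]

/-- The confluence step of Matsumoto's theorem. From two descents one continues downwards,
alternating the two generators, until both chains meet; the two words then differ by one braid
relation. The hypothesis `ih` allows any descent to be split off below `f`. -/
theorem redProd_diamond (hg : IsBraided g) (f : Fin n → X n)
    (ih : ∀ f', height f' < height f → ∀ s, Descent s f' →
      redProd g f' = redProd g (move s f') * g s)
    (s s' : Option (Fin (n - 1))) (hs : Descent s f) (hs' : Descent s' f) :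
    redProd g (move s f) * g s = redProd g (move s' f) * g s' := by
  have far : ∀ s s', Descent s f → Descent s' f → move s (move s' f) = move s' (move s f) →
      Descent s (move s' f) → Descent s' (move s f) → g s * g s' = g s' * g s →
      redProd g (move s f) * g s = redProd g (move s' f) * g s' := by
    intro s s' hs hs' hm h1 h2 hc
    rw [ih _ (height_move_lt s f hs) s' h2, ih _ (height_move_lt s' f hs') s h1, mul_assoc,
      mul_assoc, hm, hc]
  have signFar : ∀ i : Fin (n - 1), 0 < i.val → Descent none f → Descent (some i) f →
      redProd g (move none f) * g none = redProd g (move (some i) f) * g (some i) := by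
    intro i hi0 h1 h2
    have e1 : lo i ≠ 0 := by simp [lo, Fin.ext_iff]; omega
    have e2 : hi i ≠ 0 := by simp [hi, Fin.ext_iff]
    apply far _ _ h1 h2 _ _ _ (hg.sign_far i hi0)
    · funext k
      simp only [move]
      by_cases k1 : k = 0
      · subst k1
        simp [Equiv.swap_apply_of_ne_of_ne e1.symm e2.symm]
      have : Equiv.swap (lo i) (hi i) k ≠ 0 := by
        rw [Equiv.swap_apply_def]
        split_ifs <;> assumption
      simp [k1, this]
    · simpa [Descent, move, Equiv.swap_apply_of_ne_of_ne e1.symm e2.symm] using h1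
    · simpa [Descent, move, e1, e2] using h2
  have sign : ∀ i : Fin (n - 1), i.val = 0 → Descent none f → Descent (some i) f →
      redProd g (move none f) * g none = redProd g (move (some i) f) * g (some i) := by
    intro i hi0 h1 h2
    have e1 : lo i = 0 := by simp [lo, Fin.ext_iff]; omega
    have e2 : hi i ≠ 0 := by simp [hi, Fin.ext_iff]
    have v1 : ∀ f : Fin n → X n, move none f 0 = (f 0).neg := fun f => by simp [move]
    have v2 : ∀ f : Fin n → X n, move none f (hi i) = f (hi i) := fun f => by simp [move, e2]
    have v3 : ∀ f : Fin n → X n, move (some i) f 0 = f (hi i) := fun f => by simp [move, ← e1]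
    have v4 : ∀ f : Fin n → X n, move (some i) f (hi i) = f 0 := fun f => by simp [move, ← e1]
    simp only [Descent, e1] at h1 h2
    -- With first two entries b < a < 0 in the order (a, b), one chain is (a, b), (-a, b), (b, -a),
    -- (-b, -a), (-a, -b), the other (a, b), (b, a), (-b, a), (a, -b), (-a, -b).
    have a1 : Descent (some i) (move none f) := by
      simp only [Descent, e1, v1, v2, X.neg_val]; omega
    have a2 : Descent none (move (some i) (move none f)) := by
      simp only [Descent, v2, v3]; omega
    have a3 : Descent (some i) (move none (move (some i) (move none f))) := by
      simp only [Descent, e1, v1, v2, v3, v4, X.neg_val]; omega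
    have b1 : Descent none (move (some i) f) := by
      simp only [Descent, v3]; omega
    have b2 : Descent (some i) (move none (move (some i) f)) := by
      simp only [Descent, e1, v1, v2, v3, v4, X.neg_val]; omega
    have b3 : Descent none (move (some i) (move none (move (some i) f))) := by
      simp only [Descent, v2, v3, v4]; omega
    have h1 : Descent none f := h1
    have h2 : Descent (some i) f := by simpa only [Descent, e1] using h2
    have l1 := height_move_lt _ _ h1
    have l2 := height_move_lt _ _ a1
    have l3 := height_move_lt _ _ a2
    have k1 := height_move_lt _ _ h2
    have k2 := height_move_lt _ _ b1
    have k3 := height_move_lt _ _ b2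
    rw [ih _ l1 _ a1, ih _ (by omega) _ a2, ih _ (by omega) _ a3, ih _ k1 _ b1,
      ih _ (by omega) _ b2, ih _ (by omega) _ b3]
    have hm : move (some i) (move none (move (some i) (move none f))) =
        move none (move (some i) (move none (move (some i) f))) := by
      funext k
      by_cases k1 : k = 0
      · subst k1; simp only [v1, v2, v3, v4]
      by_cases k2 : k = hi i
      · subst k2; simp only [v1, v2, v3, v4]
      simp [move, e1, Equiv.swap_apply_of_ne_of_ne, k1, k2]
    have := hg.sign i hi0
    rw [hm]
    simp only [mul_assoc] at this ⊢
    rw [this]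
  have braid : ∀ i j : Fin (n - 1), i.val + 1 = j.val → Descent (some i) f → Descent (some j) f →
      redProd g (move (some i) f) * g (some i) = redProd g (move (some j) f) * g (some j) := by
    intro i j hij h1 h2
    have e1 : hi i = lo j := by simp [lo, hi, Fin.ext_iff]; omega
    have e2 : lo i ≠ lo j := by simp [lo, Fin.ext_iff]; omega
    have e3 : lo i ≠ hi j := by simp [lo, hi, Fin.ext_iff]; omega
    have e4 : lo j ≠ hi j := lo_ne_hi j
    have sw1 : Equiv.swap (lo i) (lo j) (hi j) = hi j :=
      Equiv.swap_apply_of_ne_of_ne e3.symm e4.symm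
    have sw2 : Equiv.swap (lo j) (hi j) (lo i) = lo i := Equiv.swap_apply_of_ne_of_ne e2 e3
    -- Three decreasing entries are reversed along either chain.
    have a1 : Descent (some j) (move (some i) f) := by
      simp only [Descent, move, e1, Function.comp_apply, sw1, Equiv.swap_apply_right] at *
      omega
    have a2 : Descent (some i) (move (some j) (move (some i) f)) := by
      simp only [Descent, move, e1, Function.comp_apply, sw1, sw2, Equiv.swap_apply_right,
        Equiv.swap_apply_left] at *
      omega
    have b1 : Descent (some i) (move (some j) f) := by
      simp only [Descent, move, e1, Function.comp_apply, sw2, Equiv.swap_apply_left] at *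
      omega
    have b2 : Descent (some j) (move (some i) (move (some j) f)) := by
      simp only [Descent, move, e1, Function.comp_apply, sw1, sw2, Equiv.swap_apply_right,
        Equiv.swap_apply_left] at *
      omega
    have l1 := height_move_lt _ _ h1
    have l2 := height_move_lt _ _ a1
    have k1 := height_move_lt _ _ h2
    have k2 := height_move_lt _ _ b1
    rw [ih _ l1 _ a1, ih _ (by omega) _ a2, ih _ k1 _ b1, ih _ (by omega) _ b2]
    have hm : move (some i) (move (some j) (move (some i) f)) =
        move (some j) (move (some i) (move (some j) f)) := by
      funext k
      simp only [move, Function.comp_apply, e1]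
      congr 1
      by_cases k1 : k = lo i
      · subst k1; simp [sw1, sw2]
      by_cases k2 : k = lo j
      · subst k2; simp [sw1, sw2]
      by_cases k3 : k = hi j
      · subst k3; simp [sw1, sw2]
      simp [Equiv.swap_apply_of_ne_of_ne, k1, k2, k3]
    have := hg.braid i j hij
    rw [hm]
    simp only [mul_assoc] at this ⊢
    rw [this]
  have tFar : ∀ i j : Fin (n - 1), i.val + 1 < j.val → Descent (some i) f → Descent (some j) f →
      redProd g (move (some i) f) * g (some i) = redProd g (move (some j) f) * g (some j) := by
    intro i j hij h1 h2
    have e1 : lo i ≠ lo j := by simp [lo, Fin.ext_iff]; omega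
    have e2 : lo i ≠ hi j := by simp [lo, hi, Fin.ext_iff]; omega
    have e3 : hi i ≠ lo j := by simp [lo, hi, Fin.ext_iff]; omega
    have e4 : hi i ≠ hi j := by simp [hi, Fin.ext_iff]; omega
    have w1 := Equiv.swap_apply_of_ne_of_ne e1 e2
    have w2 := Equiv.swap_apply_of_ne_of_ne e3 e4
    have w3 := Equiv.swap_apply_of_ne_of_ne e1.symm e3.symm
    have w4 := Equiv.swap_apply_of_ne_of_ne e2.symm e4.symm
    apply far _ _ h1 h2 _ _ _ (hg.far i j (Or.inl hij))
    · funext k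
      simp only [move, Function.comp_apply]
      congr 1
      by_cases k1 : k = lo i
      · subst k1; simp [w1, w2]
      by_cases k2 : k = hi i
      · subst k2; simp [w1, w2]
      by_cases k3 : k = lo j
      · subst k3; simp [w3, w4]
      by_cases k4 : k = hi j
      · subst k4; simp [w3, w4]
      simp [Equiv.swap_apply_of_ne_of_ne, k1, k2, k3, k4]
    · simpa [Descent, move, w1, w2] using h1
    · simpa [Descent, move, w3, w4] using h2
  cases s with
  | none =>
    cases s' with
    | none => rfl
    | some i =>
      rcases Nat.eq_zero_or_pos i.val with h | h
      · exact sign i h hs hs'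
      · exact signFar i h hs hs'
  | some i =>
    cases s' with
    | none =>
      rcases Nat.eq_zero_or_pos i.val with h | h
      · exact (sign i h hs' hs).symm
      · exact (signFar i h hs' hs).symm
    | some j =>
      rcases lt_trichotomy (i.val + 1) j.val with h | h | h
      · exact tFar i j h hs hs'
      · exact braid i j h hs hs'
      · rcases lt_trichotomy (j.val + 1) i.val with h' | h' | h'
        · exact (tFar j i h' hs' hs).symm
        · exact (braid j i h' hs' hs).symm
        · obtain rfl : i = j := Fin.ext (by omega)
          rfl

/-- The descent chosen in the definition of `redProd` is immaterial, so the element depends on the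
arrangement alone. -/
theorem redProd_eq (hg : IsBraided g) (f : Fin n → X n) (s : Option (Fin (n - 1)))
    (hs : Descent s f) : redProd g f = redProd g (move s f) * g s := by
  induction hN : height f using Nat.strong_induction_on generalizing f s with
  | _ N ih =>
    have h : ∃ s, Descent s f := ⟨s, hs⟩
    rw [redProd, dif_pos h]
    refine redProd_diamond hg f (fun f' h' s hs => ih _ (hN ▸ h') f' s hs rfl) _ _ h.choose_spec hs

end

/-! ### Good arrangements -/

section

variable {n : ℕ} [NeZero n]

/-- The labels of the arrangement form a permutation. -/
def IsGood (f : Fin n → X n) : Prop := Function.Injective fun k => (f k).label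

theorem IsGood.move {f : Fin n → X n} (hf : IsGood f) (s : Option (Fin (n - 1))) :
    IsGood (move s f) := by
  cases s with
  | none =>
    intro k l h
    simp only [label_move_none] at h
    exact hf h
  | some i =>
    intro k l h
    simp only [label_move_some] at h
    exact (Equiv.swap (lo i) (hi i)).injective (hf h)

omit [NeZero n] in
theorem isGood_perm (σ : Equiv.Perm (Fin n)) : IsGood fun k => X.pos (σ k) := by
  intro k l h
  simpa using h

theorem IsGood.descent_or {f : Fin n → X n} (hf : IsGood f) (s : Option (Fin (n - 1))) :
    Descent s f ∨ Descent s (BTB.move s f) := by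
  cases s with
  | none =>
    have := (f 0).ne_zero
    simp only [Descent, BTB.move, Function.update_self, X.neg_val]
    omega
  | some i =>
    have h1 : (f (lo i)).1 ≠ (f (hi i)).1 := fun h =>
      lo_ne_hi i (hf (congrArg X.label (Subtype.ext h)))
    simp only [Descent, BTB.move, Function.comp_apply, Equiv.swap_apply_left,
      Equiv.swap_apply_right]
    omega

/-- Without descents the entries are positive and strictly increasing, so the labels form a strictly
monotone self-map of `Fin n`, which is the identity. -/
theorem IsGood.eq_pos {f : Fin n → X n} (hf : IsGood f) (h : ¬ ∃ s, Descent s f) :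
    f = X.pos := by
  push Not at h
  obtain ⟨m, rfl⟩ : ∃ m, n = m + 1 := ⟨n - 1, by have := NeZero.ne n; omega⟩
  have h0 : 0 < (f 0).1 := by
    have h1 := h none
    have := (f 0).ne_zero
    simp only [Descent] at h1
    omega
  have hm : StrictMono fun k => (f k).1 := by
    rw [Fin.strictMono_iff_lt_succ]
    intro i
    have h1 := h (some i)
    have h2 := hf.descent_or (some i)
    rcases h2 with h2 | h2
    · exact absurd h2 h1
    · simp only [Descent, BTB.move, Function.comp_apply, Equiv.swap_apply_left,
        Equiv.swap_apply_right] at h2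
      exact h2
  have hpos : ∀ k, 0 < (f k).1 := fun k => h0.trans_le (hm.monotone (Fin.zero_le k))
  have hl : StrictMono fun k => (f k).label := by
    intro k l hkl
    have h1 := hm hkl
    have h2 := hpos k
    simp only [X.label, Fin.mk_lt_mk]
    dsimp only at h1
    omega
  have : (fun k => (f k).label) = id := hl.eq_id
  funext k
  rw [← X.pos_label (f k) (hpos k)]
  exact congrArg X.pos (congrFun this k)

theorem IsGood.induction {P : (Fin n → X n) → Prop} (base : P X.pos)
    (step : ∀ s f, IsGood f → Descent s f → P (BTB.move s f) → P f) {f : Fin n → X n}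
    (hf : IsGood f) : P f := by
  induction hN : height f using Nat.strong_induction_on generalizing f with
  | _ N ih =>
    by_cases h : ∃ s, Descent s f
    · obtain ⟨s, hs⟩ := h
      exact step s f hf hs (ih _ (hN ▸ height_move_lt s f hs) (hf.move s) rfl)
    · rwa [hf.eq_pos h]

theorem not_descent_pos (s : Option (Fin (n - 1))) : ¬ Descent s (X.pos (n := n)) := by
  cases s with
  | none => simp only [Descent, X.pos]; omega
  | some i => simp only [Descent, X.pos, lo, hi]; push_cast; omega

/-! ### Models of the relations -/

/-- The relations of the bt-algebra of type `B`, with arbitrary parameters. -/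
structure IsModel {R A : Type*} [CommRing R] [Ring A] [Algebra R A] (c d : R) (φ : Gen n → A) :
    Prop where
  tt_far : ∀ i j, Far i j → φ (.T i) * φ (.T j) = φ (.T j) * φ (.T i)
  tt_braid : ∀ i j : Fin (n - 1), i.val + 1 = j.val →
    φ (.T i) * φ (.T j) * φ (.T i) = φ (.T j) * φ (.T i) * φ (.T j)
  tt_same : ∀ i, φ (.T i) * φ (.T i) = 1 + c • (φ (.E i) * φ (.T i))
  ee_same : ∀ i, φ (.E i) * φ (.E i) = φ (.E i)
  ee_comm : ∀ i j, φ (.E i) * φ (.E j) = φ (.E j) * φ (.E i)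
  et_same : ∀ i, φ (.E i) * φ (.T i) = φ (.T i) * φ (.E i)
  et_far : ∀ i j, Far i j → φ (.E i) * φ (.T j) = φ (.T j) * φ (.E i)
  eet_left : ∀ i j, Near i j → φ (.E i) * φ (.E j) * φ (.T i) = φ (.T i) * φ (.E i) * φ (.E j)
  eet_right : ∀ i j, Near i j → φ (.T i) * φ (.E i) * φ (.E j) = φ (.E j) * φ (.T i) * φ (.E j)
  ett : ∀ i j, Near i j → φ (.E i) * φ (.T j) * φ (.T i) = φ (.T j) * φ (.T i) * φ (.E j)
  bt_braid : ∀ i : Fin (n - 1), i.val = 0 →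
    φ .B * φ (.T i) * φ .B * φ (.T i) = φ (.T i) * φ .B * φ (.T i) * φ .B
  bt_comm : ∀ i : Fin (n - 1), 0 < i.val → φ .B * φ (.T i) = φ (.T i) * φ .B
  bb : φ .B * φ .B = 1 + d • (φ (.F 0) * φ .B)
  be : ∀ i, φ .B * φ (.E i) = φ (.E i) * φ .B
  ff : ∀ j, φ (.F j) * φ (.F j) = φ (.F j)
  bf : ∀ j, φ .B * φ (.F j) = φ (.F j) * φ .B
  fe : ∀ j i, φ (.F j) * φ (.E i) = φ (.E i) * φ (.F j)
  ft : ∀ j i, φ (.F j) * φ (.T i) = φ (.T i) * φ (.F (Equiv.swap (lo i) (hi i) j))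
  ef_lo : ∀ i, φ (.E i) * φ (.F (lo i)) = φ (.F (lo i)) * φ (.F (hi i))
  ef_hi : ∀ i, φ (.F (lo i)) * φ (.F (hi i)) = φ (.E i) * φ (.F (hi i))

variable {R A : Type*} [CommRing R] [Ring A] [Algebra R A] {c d : R} {φ : Gen n → A}

/-- The Coxeter generators. -/
def cox (φ : Gen n → A) : Option (Fin (n - 1)) → A
  | none => φ .B
  | some i => φ (.T i)

variable (φ) in
/-- The element `T_w` for the signed permutation `w` which takes the identical arrangement to
`f`. -/
def wordElt (f : Fin n → X n) : A := redProd (cox φ) f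

theorem wordElt_pos : wordElt φ X.pos = 1 :=
  redProd_of_not _ fun ⟨s, hs⟩ => not_descent_pos s hs

namespace IsModel

variable (H : IsModel c d φ)
include H

theorem isBraided_cox : IsBraided (cox φ) where
  far := H.tt_far
  braid := H.tt_braid
  sign := H.bt_braid
  sign_far := H.bt_comm

/-- `Tᵢ` as an invertible element. -/
def unitT (i : Fin (n - 1)) : Aˣ where
  val := φ (.T i)
  inv := φ (.T i) - c • φ (.E i)
  val_inv := by rw [mul_sub, H.tt_same, mul_smul_comm, H.et_same]; abel
  inv_val := by rw [sub_mul, H.tt_same, smul_mul_assoc]; abel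

/-- `B₁` as an invertible element. -/
def unitB : Aˣ where
  val := φ .B
  inv := φ .B - d • φ (.F 0)
  val_inv := by rw [mul_sub, H.bb, mul_smul_comm, H.bf]; abel
  inv_val := by rw [sub_mul, H.bb, smul_mul_assoc]; abel

theorem isUnit_cox (s : Option (Fin (n - 1))) : IsUnit (cox φ s) := by
  cases s with
  | none => exact H.unitB.isUnit
  | some i => exact (H.unitT i).isUnit

/-- The elements `Tᵢ`, indexed by natural numbers. -/
def natT (k : ℕ) : Aˣ := if h : k < n - 1 then H.unitT ⟨k, h⟩ else 1

omit H in
variable (φ) in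
/-- The elements `Eᵢ`, indexed by natural numbers. -/
def natE (k : ℕ) : A := if h : k < n - 1 then φ (.E ⟨k, h⟩) else 1

theorem natT_eq (k : ℕ) (h : k < n - 1) : (H.natT k : A) = φ (.T ⟨k, h⟩) := by
  rw [natT, dif_pos h]; rfl

omit [NeZero n] H in
theorem natE_eq (k : ℕ) (h : k < n - 1) : natE φ k = φ (.E ⟨k, h⟩) := dif_pos h

theorem isTied : IsTied (n - 1) H.natT (natE φ) where
  tt_far i j h hj := by
    rw [H.natT_eq i (by omega), H.natT_eq j hj]
    exact H.tt_far _ _ (Or.inl h)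
  braid i h := by
    rw [H.natT_eq i (by omega), H.natT_eq _ h]
    exact H.tt_braid _ _ rfl
  et_same i h := by
    rw [H.natT_eq i h, natE_eq i h]
    exact (H.et_same _).symm
  et_far i j h hj := by
    rw [natE_eq i (by omega), H.natT_eq j hj]
    exact (H.et_far _ _ (Or.inl h)).symm
  et_far' i j h hj := by
    rw [H.natT_eq i (by omega), natE_eq j hj]
    exact (H.et_far _ _ (Or.inr h)).symm
  et_sq i h := by
    rw [natE_eq i (by omega), H.natT_eq _ h, H.tt_same]
    set a : Fin (n - 1) := ⟨i, by omega⟩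
    set c : Fin (n - 1) := ⟨i + 1, h⟩
    have hn : Near c a := Or.inr rfl
    -- After the quadratic relation only the term `E T` of the square is left to commute with the
    -- neighbouring `E`.
    have h1 : Commute (φ (.E c) * φ (.T c)) (φ (.E a)) := by
      change φ (.E c) * φ (.T c) * φ (.E a) = φ (.E a) * (φ (.E c) * φ (.T c))
      have h2 : φ (.E c) * φ (.T c) = φ (.T c) * φ (.E c) := H.et_same c
      rw [h2, H.eet_right c a hn, ← h2, ← mul_assoc, H.ee_comm a c, H.eet_left c a hn,
        H.eet_right c a hn]
    exact (Commute.one_left _).add_left (h1.smul_left _)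
  ett i h := by
    rw [natE_eq i (by omega), H.natT_eq _ h, H.natT_eq i (by omega), natE_eq _ h]
    exact H.ett ⟨i, by omega⟩ ⟨i + 1, h⟩ (Or.inl rfl)
  ee_comm i j hi hj := by
    rw [natE_eq i hi, natE_eq j hj]
    exact H.ee_comm _ _
  ete i h := by
    rw [natE_eq i (by omega), H.natT_eq _ h, natE_eq _ h]
    have hn : Near (⟨i + 1, h⟩ : Fin (n - 1)) ⟨i, by omega⟩ := Or.inr rfl
    rw [← H.eet_right _ _ hn, ← H.eet_left _ _ hn, H.ee_comm]

/-- The idempotent `E_{i,j}`. -/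
def tieElt (i j : Fin n) : A := tie H.natT (natE φ) i j

theorem tieElt_self (i : Fin n) : H.tieElt i i = 1 := tie_self _

theorem tieElt_symm (i j : Fin n) : H.tieElt i j = H.tieElt j i := tie_symm _ _

theorem tieElt_lo_hi (i : Fin (n - 1)) : H.tieElt (lo i) (hi i) = φ (.E i) := by
  simp [tieElt, tie, lo, hi, tieAux, natE_eq i.val i.2]

omit [NeZero n] H in
theorem swap_val (k : Fin (n - 1)) (i : Fin n) :
    ((Equiv.swap (lo k) (hi k) i : Fin n) : ℕ) = Equiv.swap k.val (k.val + 1) i.val := by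
  simp only [Equiv.swap_apply_def, lo, hi, Fin.ext_iff]
  split_ifs <;> rfl

theorem cox_mul_tieElt (k : Fin (n - 1)) (i j : Fin n) :
    φ (.T k) * H.tieElt (Equiv.swap (lo k) (hi k) i) (Equiv.swap (lo k) (hi k) j) =
      H.tieElt i j * φ (.T k) := by
  have := H.isTied.mul_tie i j k k.2 (by omega) (by omega)
  rw [H.natT_eq k.val k.2] at this
  rwa [tieElt, swap_val, swap_val]

theorem B_mul_tieElt (i j : Fin n) : φ .B * H.tieElt i j = H.tieElt i j * φ .B := by
  apply IsTied.commute_tie (m := n - 1)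
  · intro k hk
    rw [natE_eq k hk]
    exact H.be _
  · intro k hk
    rw [H.natT_eq _ hk]
    exact H.bt_comm ⟨k + 1, hk⟩ (Nat.succ_pos k)
  · omega
  · omega

theorem wordElt_eq (f : Fin n → X n) (s : Option (Fin (n - 1))) (h : Descent s f) :
    wordElt φ f = wordElt φ (move s f) * cox φ s := redProd_eq H.isBraided_cox f s h

theorem isUnit_wordElt {f : Fin n → X n} (hf : IsGood f) : IsUnit (wordElt φ f) := by
  refine IsGood.induction (P := fun f => IsUnit (wordElt φ f)) ?_ ?_ hf
  · rw [wordElt_pos]; exact isUnit_one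
  · intro s f hf hs ih
    rw [H.wordElt_eq f s hs]
    exact ih.mul (H.isUnit_cox s)

/-- B₁ commutes with every tie and Tₖ permutes the indices by sₖ, so signs play no role and only
labels appear. -/
theorem wordElt_mul_tieElt {f : Fin n → X n} (hf : IsGood f) (i j : Fin n) :
    wordElt φ f * H.tieElt i j = H.tieElt (f i).label (f j).label * wordElt φ f := by
  refine IsGood.induction (P := fun f => ∀ i j, wordElt φ f * H.tieElt i j =
    H.tieElt (f i).label (f j).label * wordElt φ f) ?_ ?_ hf i j
  · simp [wordElt_pos]
  · intro s f hf hs ih i j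
    rw [H.wordElt_eq f s hs]
    cases s with
    | none =>
      rw [cox, mul_assoc, H.B_mul_tieElt, ← mul_assoc, ih, label_move_none, label_move_none,
        mul_assoc]
    | some k =>
      have := H.cox_mul_tieElt k (Equiv.swap (lo k) (hi k) i) (Equiv.swap (lo k) (hi k) j)
      rw [Equiv.swap_apply_self, Equiv.swap_apply_self] at this
      rw [cox, mul_assoc, this, ← mul_assoc, ih, label_move_some, label_move_some,
        Equiv.swap_apply_self, Equiv.swap_apply_self, mul_assoc]

theorem wordElt_mul_F {f : Fin n → X n} (hf : IsGood f) (j : Fin n) :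
    wordElt φ f * φ (.F j) = φ (.F (f j).label) * wordElt φ f := by
  refine IsGood.induction (P := fun f => ∀ j, wordElt φ f * φ (.F j) =
    φ (.F (f j).label) * wordElt φ f) ?_ ?_ hf j
  · simp [wordElt_pos]
  · intro s f hf hs ih j
    rw [H.wordElt_eq f s hs]
    cases s with
    | none =>
      rw [cox, mul_assoc, H.bf, ← mul_assoc, ih, label_move_none, mul_assoc]
    | some k =>
      have := H.ft (Equiv.swap (lo k) (hi k) j) k
      rw [Equiv.swap_apply_self] at this
      rw [cox, mul_assoc, ← this, ← mul_assoc, ih, label_move_some,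
        Equiv.swap_apply_self, mul_assoc]

end IsModel

end

/-! ### Identities between the idempotents -/

section

variable {n : ℕ}

theorem exists_perm_lo_hi {i j : Fin n} (k : Fin (n - 1)) (h : i ≠ j) :
    ∃ σ : Equiv.Perm (Fin n), σ (lo k) = i ∧ σ (hi k) = j := by
  have h1 : lo k ≠ Equiv.swap (lo k) i j := by
    intro h'
    rw [eq_comm, Equiv.swap_apply_eq_iff, Equiv.swap_apply_left] at h'
    exact h h'.symm
  refine ⟨Equiv.swap (lo k) i * Equiv.swap (hi k) (Equiv.swap (lo k) i j), ?_, ?_⟩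
  · rw [Equiv.Perm.mul_apply, Equiv.swap_apply_of_ne_of_ne (lo_ne_hi k) h1,
      Equiv.swap_apply_left]
  · rw [Equiv.Perm.mul_apply, Equiv.swap_apply_left, Equiv.swap_apply_self]

namespace IsModel

variable [NeZero n]
variable {R A : Type*} [CommRing R] [Ring A] [Algebra R A] {c d : R} {φ : Gen n → A}
  (H : IsModel c d φ)
include H

theorem exists_conj (σ : Equiv.Perm (Fin n)) : ∃ w : Aˣ,
    (∀ k l, w * H.tieElt k l = H.tieElt (σ k) (σ l) * w) ∧
      ∀ k, w * φ (.F k) = φ (.F (σ k)) * w := by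
  obtain ⟨w, hw⟩ := H.isUnit_wordElt (isGood_perm σ)
  refine ⟨w, fun k l => ?_, fun k => ?_⟩
  · rw [hw, H.wordElt_mul_tieElt (isGood_perm σ), X.label_pos, X.label_pos]
  · rw [hw, H.wordElt_mul_F (isGood_perm σ), X.label_pos]

/-- To prove an identity between the `E_{i,j}` and the `Fⱼ`, one may move two of the indices to the
first two positions. -/
theorem exists_conj_of_ne {i j : Fin n} (h : i ≠ j) :
    ∃ k : Fin (n - 1), k.val = 0 ∧ ∃ (w : Aˣ) (σ : Equiv.Perm (Fin n)),
      σ (lo k) = i ∧ σ (hi k) = j ∧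
      (∀ k l, w * H.tieElt k l = H.tieElt (σ k) (σ l) * w) ∧
      ∀ k, w * φ (.F k) = φ (.F (σ k)) * w := by
  have hn : 0 < n - 1 := by
    have := i.2
    have := j.2
    have : i.val ≠ j.val := fun h' => h (Fin.ext h')
    omega
  obtain ⟨σ, h1, h2⟩ := exists_perm_lo_hi ⟨0, hn⟩ h
  obtain ⟨w, h3, h4⟩ := H.exists_conj σ
  exact ⟨⟨0, hn⟩, rfl, w, σ, h1, h2, h3, h4⟩

omit [NeZero n] H in
-- The identities below all have the form x y = z t; this transports them along the unit of
-- `exists_conj_of_ne`.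
theorem mul_eq_of_conj {w : Aˣ} {x y z t x' y' z' t' : A} (hx : w * x = x' * w)
    (hy : w * y = y' * w) (hz : w * z = z' * w) (ht : w * t = t' * w) (h : x * y = z * t) :
    x' * y' = z' * t' := by
  rw [← w.mul_left_inj, mul_assoc, ← hy, ← mul_assoc, ← hx, mul_assoc, h, ← mul_assoc, hz,
    mul_assoc, ht, mul_assoc]

theorem commute_tieElt_tieElt (i j k l : Fin n) : Commute (H.tieElt i j) (H.tieElt k l) := by
  rcases eq_or_ne i j with rfl | hij
  · rw [H.tieElt_self]
    exact Commute.one_left _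
  obtain ⟨m, hm, w, σ, rfl, rfl, hE, -⟩ := H.exists_conj_of_ne hij
  obtain ⟨k, rfl⟩ := σ.surjective k
  obtain ⟨l, rfl⟩ := σ.surjective l
  refine mul_eq_of_conj (hE _ _) (hE _ _) (hE _ _) (hE _ _) ?_
  obtain ⟨m, hm'⟩ := m
  obtain rfl : m = 0 := hm
  rw [H.tieElt_lo_hi, ← natE_eq (φ := φ) 0 hm']
  exact H.isTied.commute_zero_tie k l (by omega) (by omega)

theorem commute_tieElt_F (i j k : Fin n) : Commute (H.tieElt i j) (φ (.F k)) := by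
  rcases eq_or_ne i j with rfl | hij
  · rw [H.tieElt_self]
    exact Commute.one_left _
  obtain ⟨m, hm, w, σ, rfl, rfl, hE, hF⟩ := H.exists_conj_of_ne hij
  obtain ⟨k, rfl⟩ := σ.surjective k
  refine mul_eq_of_conj (hE _ _) (hF _) (hF _) (hE _ _) ?_
  rw [H.tieElt_lo_hi, H.fe]

theorem tieElt_mul_F (i j : Fin n) :
    H.tieElt i j * φ (.F i) = φ (.F i) * φ (.F j) := by
  rcases eq_or_ne i j with rfl | hij
  · rw [H.tieElt_self, H.ff, one_mul]
  obtain ⟨m, hm, w, σ, rfl, rfl, hE, hF⟩ := H.exists_conj_of_ne hij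
  refine mul_eq_of_conj (hE _ _) (hF _) (hF _) (hF _) ?_
  rw [H.tieElt_lo_hi, H.ef_lo]

theorem tieElt_mul_F' (i j : Fin n) :
    H.tieElt i j * φ (.F j) = φ (.F i) * φ (.F j) := by
  rcases eq_or_ne i j with rfl | hij
  · rw [H.tieElt_self, H.ff, one_mul]
  obtain ⟨m, hm, w, σ, rfl, rfl, hE, hF⟩ := H.exists_conj_of_ne hij
  refine mul_eq_of_conj (hE _ _) (hF _) (hF _) (hF _) ?_
  rw [H.tieElt_lo_hi, H.ef_hi]

/-- This is not a defining relation: both products equal E_{i,j} Fᵢ. -/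
theorem commute_F_F (i j : Fin n) : Commute (φ (.F i)) (φ (.F j)) := by
  have := H.tieElt_mul_F' j i
  rw [H.tieElt_symm, H.tieElt_mul_F] at this
  exact this

theorem tieElt_mul_self (i j : Fin n) : H.tieElt i j * H.tieElt i j = H.tieElt i j := by
  rcases eq_or_ne i j with rfl | hij
  · simp [H.tieElt_self]
  obtain ⟨m, hm, w, σ, rfl, rfl, hE, hF⟩ := H.exists_conj_of_ne hij
  have := mul_eq_of_conj (hE (lo m) (hi m)) (hE (lo m) (hi m)) (hE (lo m) (hi m))
    (show (w : A) * 1 = 1 * w by simp) (by rw [H.tieElt_lo_hi, H.ee_same, mul_one])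
  rwa [mul_one] at this

theorem tieElt_mul_tieElt (i j k : Fin n) :
    H.tieElt i j * H.tieElt j k = H.tieElt i j * H.tieElt i k := by
  rcases eq_or_ne i j with rfl | hij
  · rfl
  obtain ⟨m, hm, w, σ, rfl, rfl, hE, hF⟩ := H.exists_conj_of_ne hij
  obtain ⟨k, rfl⟩ := σ.surjective k
  refine mul_eq_of_conj (hE _ _) (hE _ _) (hE _ _) (hE _ _) ?_
  rcases eq_or_ne k (lo m) with rfl | h1
  · rw [H.tieElt_self, H.tieElt_symm (hi m), H.tieElt_mul_self, mul_one]
  rcases eq_or_ne k (hi m) with rfl | h2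
  · rw [H.tieElt_self, H.tieElt_mul_self, mul_one]
  -- The index `k` is now outside the first two positions, which is what `zero_mul_tie` requires.
  obtain ⟨m, hm'⟩ := m
  obtain rfl : m = 0 := hm
  rw [H.tieElt_lo_hi, ← natE_eq (φ := φ) 0 hm']
  refine H.isTied.zero_mul_tie k (by omega) ?_
  simp only [lo, hi, ne_eq, Fin.ext_iff] at h1 h2
  omega

/-! ### Separating idempotents -/

/-- The family of the elements `E_{i,j}` and `Fⱼ`. -/
def tieFamily : (Fin n × Fin n) ⊕ Fin n → A :=
  Sum.elim (fun p => H.tieElt p.1 p.2) fun j => φ (.F j)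

theorem commute_tieFamily (x y) : Commute (H.tieFamily x) (H.tieFamily y) := by
  rcases x with ⟨i, j⟩ | i <;> rcases y with ⟨k, l⟩ | k
  · exact H.commute_tieElt_tieElt _ _ _ _
  · exact H.commute_tieElt_F _ _ _
  · exact (H.commute_tieElt_F _ _ _).symm
  · exact H.commute_F_F _ _

theorem tieFamily_mul_self (x) : H.tieFamily x * H.tieFamily x = H.tieFamily x := by
  rcases x with ⟨i, j⟩ | i
  · exact H.tieElt_mul_self _ _
  · exact H.ff _

omit [NeZero n] H in
-- Induction on the finite set. Since e a is the sum of g x e a and (1 - g x) e a, one of the two is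
-- nonzero, and e is multiplied by the corresponding idempotent.
theorem exists_separating {ι : Type*} (g : ι → A) (hc : ∀ x y, Commute (g x) (g y))
    (hi : ∀ x, g x * g x = g x) {a : A} (ha : a ≠ 0) (s : Finset ι) :
    ∃ e : A, e * a ≠ 0 ∧ e * e = e ∧ e ∈ Algebra.adjoin R (Set.range g) ∧
      (∀ x, Commute (g x) e) ∧ ∀ x ∈ s, g x * e = e ∨ g x * e = 0 := by
  classical
  induction s using Finset.induction_on with
  | empty => exact ⟨1, by simpa, by simp, one_mem _, fun x => Commute.one_right _, by simp⟩
  | insert x s _ ih =>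
    obtain ⟨e, h1, h2, h3, h4, h5⟩ := ih
    have key : ∀ p : A, p * p = p → p ∈ Algebra.adjoin R (Set.range g) →
        (∀ y, Commute (g y) p) → Commute p e → (g x * p = p ∨ g x * p = 0) → p * e * a ≠ 0 →
        ∃ e : A, e * a ≠ 0 ∧ e * e = e ∧ e ∈ Algebra.adjoin R (Set.range g) ∧
          (∀ x, Commute (g x) e) ∧ ∀ y ∈ insert x s, g y * e = e ∨ g y * e = 0 := by
      intro p hp hm hpc hpe hx hne
      refine ⟨p * e, hne, ?_, mul_mem hm h3, fun y => (hpc y).mul_right (h4 y), ?_⟩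
      · rw [mul_assoc, ← mul_assoc e, ← hpe.eq, mul_assoc, h2, ← mul_assoc, hp]
      · intro y hy
        rw [Finset.mem_insert] at hy
        rcases hy with rfl | hy
        · rw [← mul_assoc]
          rcases hx with hx | hx
          · left; rw [hx]
          · right; rw [hx, zero_mul]
        · rw [← mul_assoc, (hpc y).eq, mul_assoc]
          rcases h5 y hy with hy | hy
          · left; rw [hy]
          · right; rw [hy, mul_zero]
    have hmem : g x ∈ Algebra.adjoin R (Set.range g) := Algebra.subset_adjoin ⟨x, rfl⟩
    by_cases h : g x * e * a = 0
    · refine key (1 - g x) (by simp [mul_sub, sub_mul, hi]) (sub_mem (one_mem _) hmem)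
        (fun y => (Commute.one_right _).sub_right (hc y x))
        ((Commute.one_left _).sub_left (h4 x)) (Or.inr (by simp [mul_sub, hi])) ?_
      rwa [sub_mul, sub_mul, h, one_mul, sub_zero]
    · exact key (g x) (hi x) hmem (fun y => hc y x) (h4 x) (Or.inl (hi x)) h

end IsModel

end

/-! ### Faithfulness -/

section

namespace IsModel

variable {n : ℕ} [NeZero n] {R A : Type*} [Field R] [Ring A] [Algebra R A] {c d : R}
  {φ : Gen n → A} (H : IsModel c d φ)
include H

/-- A colouring of the labels which records the products of an idempotent with the `E_{i,j}` and
the `Fⱼ`. -/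
theorem exists_colouring (e : A) :
    ∃ r : Fin n → Fin (n + 1), (∀ i j, r i = r j ↔ H.tieElt i j * e = e) ∧
      ∀ i, r i = 0 ↔ φ (.F i) * e = e := by
  classical
  have hEF : ∀ i j, H.tieElt i j * e = e → φ (.F i) * e = e → φ (.F j) * e = e := by
    intro i j h1 h2
    calc φ (.F j) * e = φ (.F j) * (H.tieElt i j * e) := by rw [h1]
      _ = H.tieElt i j * (φ (.F i) * e) := by
        rw [← mul_assoc, ← (H.commute_tieElt_F i j j).eq, H.tieElt_mul_F', ← H.tieElt_mul_F,
          mul_assoc]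
      _ = e := by rw [h2, h1]
  have hFE : ∀ i j, φ (.F i) * e = e → φ (.F j) * e = e → H.tieElt i j * e = e := by
    intro i j h1 h2
    calc H.tieElt i j * e = H.tieElt i j * (φ (.F i) * e) := by rw [h1]
      _ = φ (.F i) * (φ (.F j) * e) := by rw [← mul_assoc, H.tieElt_mul_F, mul_assoc]
      _ = e := by rw [h2, h1]
  have hsymm : ∀ i j, H.tieElt i j * e = e → H.tieElt j i * e = e := fun i j h => by
    rwa [H.tieElt_symm]
  let S : Setoid (Fin n) :=
    { r := fun i j => H.tieElt i j * e = e
      iseqv :=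
        { refl := fun i => by rw [H.tieElt_self, one_mul]
          symm := fun {i j} => hsymm i j
          trans := fun {i j k} h1 h2 => by
            calc H.tieElt i k * e = H.tieElt i k * (H.tieElt i j * e) := by rw [h1]
              _ = H.tieElt i j * (H.tieElt j k * e) := by
                rw [← mul_assoc, (H.commute_tieElt_tieElt i k i j).eq, ← H.tieElt_mul_tieElt,
                  mul_assoc]
              _ = e := by rw [h2, h1] } }
  -- Colour 0 is reserved for the labels whose F fixes `e`; another class gets the successor of its
  -- representative, so `n + 1` colours suffice.
  refine ⟨fun i => if φ (.F i) * e = e then 0 else (Quotient.out (Quotient.mk S i)).succ,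
    fun i j => ?_, fun i => ?_⟩
  · by_cases h1 : φ (.F i) * e = e <;> by_cases h2 : φ (.F j) * e = e
    · simpa [h1, h2] using hFE i j h1 h2
    · simp only [h1, h2, if_true, if_false]
      exact ⟨fun h => absurd h.symm (Fin.succ_ne_zero _), fun h => absurd (hEF i j h h1) h2⟩
    · simp only [h1, h2, if_true, if_false]
      exact ⟨fun h => absurd h (Fin.succ_ne_zero _),
        fun h => absurd (hEF j i (hsymm i j h) h2) h1⟩
    · simp only [h1, h2, if_false, Fin.succ_inj, Quotient.out_inj]
      exact Quotient.eq (r := S)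
  · by_cases h1 : φ (.F i) * e = e <;> simp [h1, Fin.succ_ne_zero]

omit H in
variable (R φ) in
/-- The span of the products of an element with the `T_w`. -/
def wordSpan (e : A) : Submodule R A :=
  Submodule.span R (Set.range fun f : {f : Fin n → X n // IsGood f} => e * wordElt φ f.1)

/-- The span contains `e` and is stable under right multiplication: an idempotent to the right of
T_w crosses to the left, where `e` absorbs it or is killed by it. -/
theorem mul_mem_wordSpan {e : A} (he : ∀ x, Commute (H.tieFamily x) e)
    (he' : ∀ x, H.tieFamily x * e = e ∨ H.tieFamily x * e = 0)
    (hgen : Algebra.adjoin R (Set.range φ) = ⊤) (a : A) : e * a ∈ wordSpan R φ e := by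
  have hmem : ∀ f : Fin n → X n, IsGood f → e * wordElt φ f ∈ wordSpan R φ e :=
    fun f hf => Submodule.subset_span ⟨⟨f, hf⟩, rfl⟩
  have hx : ∀ x (f : Fin n → X n), IsGood f →
      e * (H.tieFamily x * wordElt φ f) ∈ wordSpan R φ e := by
    intro x f hf
    rw [← mul_assoc, ← (he x).eq]
    rcases he' x with h | h
    · rw [h]; exact hmem f hf
    · rw [h, zero_mul]; exact zero_mem _
  have hE : ∀ i (f : Fin n → X n), IsGood f →
      e * (wordElt φ f * φ (.E i)) ∈ wordSpan R φ e := by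
    intro i f hf
    rw [← H.tieElt_lo_hi, H.wordElt_mul_tieElt hf]
    exact hx (Sum.inl (_, _)) f hf
  have hF : ∀ i (f : Fin n → X n), IsGood f →
      e * (wordElt φ f * φ (.F i)) ∈ wordSpan R φ e := by
    intro i f hf
    rw [H.wordElt_mul_F hf]
    exact hx (Sum.inr _) f hf
  have hcox : ∀ s (f : Fin n → X n), IsGood f →
      e * (wordElt φ f * cox φ s) ∈ wordSpan R φ e := by
    intro s f hf
    -- At a descent the last letter of the word is `s` and the quadratic relation applies; otherwise
    -- the product is again some T_w.
    rcases hf.descent_or s with h | h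
    · have hw := H.wordElt_eq f s h
      cases s with
      | none =>
        have : wordElt φ f * cox φ none =
            wordElt φ (move none f) + d • (wordElt φ f * φ (.F 0)) := by
          rw [hw, cox, mul_assoc, H.bb, mul_add, mul_one, mul_smul_comm, ← H.bf, mul_assoc]
        rw [this, mul_add, mul_smul_comm]
        exact add_mem (hmem _ (hf.move _)) (Submodule.smul_mem _ _ (hF _ _ hf))
      | some i =>
        have : wordElt φ f * cox φ (some i) =
            wordElt φ (move (some i) f) + c • (wordElt φ f * φ (.E i)) := by
          rw [hw, cox, mul_assoc, H.tt_same, mul_add, mul_one, mul_smul_comm, H.et_same,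
            mul_assoc]
        rw [this, mul_add, mul_smul_comm]
        exact add_mem (hmem _ (hf.move _)) (Submodule.smul_mem _ _ (hE _ _ hf))
    · have hw := H.wordElt_eq _ s h
      rw [move_move] at hw
      rw [← hw]
      exact hmem _ (hf.move s)
  have hmul : ∀ a : A, ∀ x ∈ wordSpan R φ e, x * a ∈ wordSpan R φ e := by
    intro a
    have ha : a ∈ Algebra.adjoin R (Set.range φ) := hgen ▸ Algebra.mem_top
    induction ha using Algebra.adjoin_induction with
    | mem a ha =>
      obtain ⟨g, rfl⟩ := ha
      intro x hx
      induction hx using Submodule.span_induction with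
      | mem x hx =>
        obtain ⟨⟨f, hf⟩, rfl⟩ := hx
        rw [mul_assoc]
        cases g with
        | B => exact hcox none f hf
        | T i => exact hcox (some i) f hf
        | E i => exact hE i f hf
        | F i => exact hF i f hf
      | zero => rw [zero_mul]; exact zero_mem _
      | add x y _ _ hx hy => rw [add_mul]; exact add_mem hx hy
      | smul t x _ hx => rw [smul_mul_assoc]; exact Submodule.smul_mem _ _ hx
    | algebraMap t =>
      intro x hx
      rw [← Algebra.commutes, ← Algebra.smul_def]
      exact Submodule.smul_mem _ _ hx
    | add a b _ _ ha hb => intro x hx; rw [mul_add]; exact add_mem (ha x hx) (hb x hx)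
    | mul a b _ _ ha hb => intro x hx; rw [← mul_assoc]; exact hb _ (ha x hx)
  have h1 := hmem _ (isGood_perm (Equiv.refl (Fin n)))
  have h2 : wordElt φ (fun k : Fin n => X.pos (Equiv.refl (Fin n) k)) = 1 := wordElt_pos
  rw [h2, mul_one] at h1
  exact hmul a e h1

/-- A representation of a model of the relations in which the vectors `vec f r`, for each colouring
`r` of the labels, behave as in the tensor space is faithful. -/
theorem injective_of_vec {M : Type*} [AddCommGroup M] [Module R M]
    (hgen : Algebra.adjoin R (Set.range φ) = ⊤) (Ψ : A →ₐ[R] (Module.End R M)ᵐᵒᵖ)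
    (vec : (Fin n → X n) → (Fin n → Fin (n + 1)) → M)
    (hind : ∀ r, LinearIndependent R fun f => vec f r)
    (hcox : ∀ s f r, Descent s f → (Ψ (cox φ s)).unop (vec (move s f) r) = vec f r)
    (hE : ∀ i f r, (Ψ (φ (.E i))).unop (vec f r) =
      (if r (f (lo i)).label = r (f (hi i)).label then (1 : R) else 0) • vec f r)
    (hF : ∀ i f r, (Ψ (φ (.F i))).unop (vec f r) =
      (if r (f i).label = 0 then (1 : R) else 0) • vec f r) :
    Function.Injective Ψ := by
  have hmul : ∀ a b m, (Ψ (a * b)).unop m = (Ψ b).unop ((Ψ a).unop m) := by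
    intro a b m
    rw [map_mul, MulOpposite.unop_mul, Module.End.mul_apply]
  have hone : ∀ m, (Ψ 1).unop m = m := by
    intro m
    rw [map_one, MulOpposite.unop_one, Module.End.one_apply]
  have hword : ∀ r f, IsGood f → (Ψ (wordElt φ f)).unop (vec X.pos r) = vec f r := by
    intro r f hf
    refine IsGood.induction
      (P := fun f => (Ψ (wordElt φ f)).unop (vec X.pos r) = vec f r) ?_ ?_ hf
    · rw [wordElt_pos, hone]
    · intro s f hf hs ih
      rw [H.wordElt_eq f s hs, hmul, ih, hcox s f r hs]
  have hpermF : ∀ i r, (Ψ (φ (.F i))).unop (vec X.pos r) =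
      (if r i = 0 then (1 : R) else 0) • vec X.pos r := by
    intro i r
    rw [hF, X.label_pos]
  have hpermE : ∀ i j r, (Ψ (H.tieElt i j)).unop (vec X.pos r) =
      (if r i = r j then (1 : R) else 0) • vec X.pos r := by
    intro i j r
    rcases eq_or_ne i j with rfl | hij
    · rw [H.tieElt_self, hone, if_pos rfl, one_smul]
    -- The eigenvalue is known for neighbouring positions; the invertible T_σ carries it over to the
    -- pair `i`, `j`.
    obtain ⟨k, -, -⟩ := H.exists_conj_of_ne hij
    obtain ⟨σ, rfl, rfl⟩ := exists_perm_lo_hi k hij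
    have hg := isGood_perm σ
    obtain ⟨w, hw⟩ := H.isUnit_wordElt hg
    have h1 := H.wordElt_mul_tieElt hg (lo k) (hi k)
    simp only [X.label_pos] at h1
    have h2 := congrArg (fun a => (Ψ a).unop (vec X.pos r)) h1
    simp only [hmul, hword r _ hg, H.tieElt_lo_hi, hE, X.label_pos] at h2
    rw [← hword r _ hg, ← map_smul, ← hw] at h2
    have h3 := congrArg (Ψ ↑w⁻¹).unop h2
    rwa [← hmul, ← hmul, Units.mul_inv, hone, hone, eq_comm] at h3
  rw [injective_iff_map_eq_zero]
  intro a ha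
  by_contra hne
  obtain ⟨e, h1, h2, h3, h4, h5⟩ := exists_separating (R := R) H.tieFamily H.commute_tieFamily
    H.tieFamily_mul_self hne Finset.univ
  replace h5 := fun x => h5 x (Finset.mem_univ x)
  have he0 : e ≠ 0 := fun h => h1 (by rw [h, zero_mul])
  obtain ⟨r, hrE, hrF⟩ := H.exists_colouring e
  -- The idempotents act on `e` and on the starting vector by one character. At `p = e` idempotence
  -- and `e ≠ 0` force the value 1, so `e` fixes the vector.
  have hchar : ∀ p ∈ Algebra.adjoin R (Set.range H.tieFamily),
      ∃ t : R, p * e = t • e ∧ (Ψ p).unop (vec X.pos r) = t • vec X.pos r := by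
    intro p hp
    induction hp using Algebra.adjoin_induction with
    | mem p hp =>
      obtain ⟨x, rfl⟩ := hp
      rcases x with ⟨i, j⟩ | i
      · refine ⟨_, ?_, hpermE i j r⟩
        rcases h5 (Sum.inl (i, j)) with h | h
        · rw [if_pos ((hrE i j).2 h), h, one_smul]
        · rw [if_neg (fun h' => he0 (((hrE i j).1 h').symm.trans h)), h, zero_smul]
      · refine ⟨_, ?_, hpermF i r⟩
        rcases h5 (Sum.inr i) with h | h
        · rw [if_pos ((hrF i).2 h), h, one_smul]
        · rw [if_neg (fun h' => he0 (((hrF i).1 h').symm.trans h)), h, zero_smul]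
    | algebraMap t =>
      refine ⟨t, by rw [Algebra.smul_def], ?_⟩
      rw [Algebra.algebraMap_eq_smul_one, map_smul, MulOpposite.unop_smul,
        LinearMap.smul_apply, hone]
    | add p q _ _ hp hq =>
      obtain ⟨s, hs1, hs2⟩ := hp
      obtain ⟨t, ht1, ht2⟩ := hq
      refine ⟨s + t, by rw [add_mul, hs1, ht1, add_smul], ?_⟩
      rw [map_add, MulOpposite.unop_add, LinearMap.add_apply, hs2, ht2, add_smul]
    | mul p q _ _ hp hq =>
      obtain ⟨s, hs1, hs2⟩ := hp
      obtain ⟨t, ht1, ht2⟩ := hq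
      refine ⟨s * t, ?_, ?_⟩
      · rw [mul_assoc, ht1, mul_smul_comm, hs1, smul_smul, mul_comm]
      · rw [hmul, hs2, map_smul, ht2, smul_smul]
  obtain ⟨t, ht1, ht2⟩ := hchar e h3
  obtain rfl : t = 1 := by
    rw [h2] at ht1
    have : (1 - t) • e = 0 := by rw [sub_smul, one_smul, ← ht1, sub_self]
    exact (sub_eq_zero.1 ((smul_eq_zero.1 this).resolve_right he0)).symm
  rw [one_smul] at ht2
  have hspan := H.mul_mem_wordSpan (R := R) h4 h5 hgen a
  rw [wordSpan, Finsupp.mem_span_range_iff_exists_finsupp] at hspan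
  obtain ⟨l, hl⟩ := hspan
  -- Evaluating the expansion of `e * a` at the starting vector turns each e T_w into its own `vec f
  -- r`.
  have hzero : l.sum (fun f t => t • vec f.1 r) = 0 := by
    have h6 : (Ψ (e * a)).unop (vec X.pos r) = 0 := by
      rw [map_mul, ha, mul_zero, MulOpposite.unop_zero, LinearMap.zero_apply]
    rw [← hl, Finsupp.sum, map_sum, Finset.unop_sum, LinearMap.sum_apply] at h6
    rw [← h6, Finsupp.sum]
    refine Finset.sum_congr rfl fun f _ => ?_
    rw [map_smul, MulOpposite.unop_smul, LinearMap.smul_apply, hmul, ht2, hword r f.1 f.2]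
  have hli := (hind r).comp (fun f : {f : Fin n → X n // IsGood f} => f.1)
    Subtype.val_injective
  have hl0 : l = 0 := (linearIndependent_iff.1 hli) l (by
    rw [Finsupp.linearCombination_apply]; exact hzero)
  rw [hl0, Finsupp.sum_zero_index] at hl
  exact h1 hl.symm

end IsModel

end

/-! ### The Yang–Baxter and reflection equations -/

section

variable {n : ℕ} {R M : Type*} [CommRing R] [AddCommGroup M] [Module R M]

theorem diagCoeff_zero_or (c : R) (p q : X n × Fin (n + 1)) :
    diagCoeff c p q = 0 ∨ diagCoeff c p q = c := by
  unfold diagCoeff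
  split_ifs <;> simp

theorem diagCoeff_of_ne (c : R) {p q : X n × Fin (n + 1)} (h : p.2 ≠ q.2) :
    diagCoeff c p q = 0 := if_neg fun h' => h h'.1

theorem diagCoeff_self (c : R) (p : X n × Fin (n + 1)) : diagCoeff c p p = 0 :=
  if_neg fun h => lt_irrefl _ h.2

theorem diagCoeff_add (c : R) {p q : X n × Fin (n + 1)} (h : p ≠ q) :
    diagCoeff c p q + diagCoeff c q p = if p.2 = q.2 then c else 0 := by
  unfold diagCoeff
  by_cases h2 : p.2 = q.2
  · have h1 : p.1.1 ≠ q.1.1 := fun h' => h (Prod.ext (Subtype.ext h') h2)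
    rcases lt_or_gt_of_ne h1 with h3 | h3 <;> simp [h2, h3, h3.not_gt]
  · simp [h2, Ne.symm h2]

theorem diagCoeff_mul_symm (c : R) (p q : X n × Fin (n + 1)) :
    diagCoeff c p q * diagCoeff c q p = 0 := by
  unfold diagCoeff
  split_ifs with h1 h2
  · exact absurd h2.2 h1.2.not_gt
  all_goals simp

theorem diagCoeff_sq (c : R) (p q : X n × Fin (n + 1)) :
    diagCoeff c p q * diagCoeff c p q = c * diagCoeff c p q := by
  rcases diagCoeff_zero_or c p q with h | h <;> simp [h]

/-- All products vanish unless the three colours agree. Then the right side says that `r` has the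
smallest index, and the left side splits this by the order of `p` and `q`. -/
theorem diagCoeff_triple (c : R) {p q r : X n × Fin (n + 1)} (h1 : p ≠ q) (h2 : q ≠ r)
    (h3 : p ≠ r) :
    diagCoeff c p r * diagCoeff c q p + diagCoeff c p q * diagCoeff c q r =
      diagCoeff c q r * diagCoeff c p r := by
  obtain ⟨⟨a, ha⟩, i⟩ := p
  obtain ⟨⟨b, hb⟩, j⟩ := q
  obtain ⟨⟨e, he⟩, k⟩ := r
  simp only [ne_eq, Prod.mk.injEq, Subtype.mk.injEq, not_and] at h1 h2 h3
  simp only [diagCoeff]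
  by_cases hij : i = j <;> by_cases hjk : j = k
  · subst hij; subst hjk
    have h1' : a ≠ b := fun h => h1 h rfl
    have h2' : b ≠ e := fun h => h2 h rfl
    have h3' : a ≠ e := fun h => h3 h rfl
    simp only [true_and]
    split_ifs <;> first | omega | ring
  · subst hij
    simp [hjk]
  · subst hjk
    simp [hij, Ne.symm hij]
  · by_cases hik : i = k
    · subst hik
      simp [hij, hjk]
    · simp [hij, hjk, hik]

/-- As before, now with `p` largest and a split by the order of `q` and `r`. -/
theorem diagCoeff_triple' (c : R) {p q r : X n × Fin (n + 1)} (h1 : p ≠ q) (h2 : q ≠ r)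
    (h3 : p ≠ r) :
    diagCoeff c p r * diagCoeff c r q + diagCoeff c q r * diagCoeff c p q =
      diagCoeff c p q * diagCoeff c p r := by
  obtain ⟨⟨a, ha⟩, i⟩ := p
  obtain ⟨⟨b, hb⟩, j⟩ := q
  obtain ⟨⟨e, he⟩, k⟩ := r
  simp only [ne_eq, Prod.mk.injEq, Subtype.mk.injEq, not_and] at h1 h2 h3
  simp only [diagCoeff]
  by_cases hij : i = j <;> by_cases hjk : j = k
  · subst hij; subst hjk
    have h1' : a ≠ b := fun h => h1 h rfl
    have h2' : b ≠ e := fun h => h2 h rfl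
    have h3' : a ≠ e := fun h => h3 h rfl
    simp only [true_and]
    split_ifs <;> first | omega | ring
  · subst hij
    simp [hjk, Ne.symm hjk]
  · subst hjk
    simp [hij]
  · by_cases hik : i = k
    · subst hik
      simp [hij, hjk]
    · simp [hij, hjk, hik]

theorem swapCoeff_self (u : R) (p : X n × Fin (n + 1)) : swapCoeff u p p = u := if_pos rfl

theorem swapCoeff_of_ne (u : R) {p q : X n × Fin (n + 1)} (h : p ≠ q) : swapCoeff u p q = 1 :=
  if_neg h

/-- Coefficients are compared on the rearrangements of `(p, q, r)`. The equation for `u` enters only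
when exactly one neighbouring pair coincides; for three distinct entries the triple identities are
decisive. -/
theorem yangBaxter {u c : R} (hu : u * u = 1 + c * u)
    (w : X n × Fin (n + 1) → X n × Fin (n + 1) → X n × Fin (n + 1) → M) (S T : Module.End R M)
    (hS : ∀ p q r, S (w p q r) = swapCoeff u p q • w q p r + diagCoeff c p q • w p q r)
    (hT : ∀ p q r, T (w p q r) = swapCoeff u q r • w p r q + diagCoeff c q r • w p q r)
    (p q r : X n × Fin (n + 1)) : S (T (S (w p q r))) = T (S (T (w p q r))) := by
  simp only [hS, hT, map_add, map_smul]
  by_cases hpq : p = q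
  · subst hpq
    by_cases hpr : p = r
    · subst hpr
      simp only [swapCoeff_self, diagCoeff_self]
    · simp only [swapCoeff_self, swapCoeff_of_ne u hpr, swapCoeff_of_ne u (Ne.symm hpr),
        diagCoeff_self]
      have h1 := diagCoeff_mul_symm c p r
      have h2 := diagCoeff_sq c p r
      match_scalars
      · ring
      · linear_combination -h1
      · linear_combination diagCoeff c p r * hu - u * h2
  · by_cases hqr : q = r
    · subst hqr
      simp only [swapCoeff_self, swapCoeff_of_ne u hpq, swapCoeff_of_ne u (Ne.symm hpq),
        diagCoeff_self]
      have h1 := diagCoeff_mul_symm c p q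
      have h2 := diagCoeff_sq c p q
      match_scalars
      · ring
      · linear_combination u * h2 - diagCoeff c p q * hu
      · linear_combination h1
    · by_cases hpr : p = r
      · subst hpr
        simp only [swapCoeff_self, swapCoeff_of_ne u hpq, swapCoeff_of_ne u (Ne.symm hpq),
          diagCoeff_self]
        have h1 := diagCoeff_mul_symm c p q
        match_scalars
        · linear_combination (diagCoeff c p q - diagCoeff c q p) * h1
        · linear_combination h1
        · linear_combination -h1
      · simp only [swapCoeff_of_ne u hpq, swapCoeff_of_ne u hqr, swapCoeff_of_ne u hpr,
          swapCoeff_of_ne u (Ne.symm hpq), swapCoeff_of_ne u (Ne.symm hqr)]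
        have h1 := diagCoeff_triple c hpq hqr hpr
        have h2 := diagCoeff_triple' c hpq hqr hpr
        have h3 := diagCoeff_sq c p q
        have h4 := diagCoeff_sq c q r
        match_scalars
        · ring
        · ring
        · linear_combination diagCoeff c q r * h3 - diagCoeff c p q * h4
        · linear_combination h1
        · ring
        · linear_combination -h2

theorem flip_flip (p : X n × Fin (n + 1)) : flip (flip p) = p := by simp [flip]

theorem signCoeff_zero_or (d : R) (p : X n × Fin (n + 1)) :
    signCoeff d p = 0 ∨ signCoeff d p = d := by
  unfold signCoeff
  split_ifs <;> simp

theorem signCoeff_sq (d : R) (p : X n × Fin (n + 1)) :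
    signCoeff d p * signCoeff d p = d * signCoeff d p := by
  rcases signCoeff_zero_or d p with h | h <;> simp [h]

theorem signCoeff_flip (d : R) (p : X n × Fin (n + 1)) :
    signCoeff d (flip p) + signCoeff d p = if p.2 = 0 then d else 0 := by
  have := p.1.ne_zero
  unfold signCoeff
  by_cases h : p.2 = 0
  · rcases lt_or_gt_of_ne this with h1 | h1
    · simp [flip, h, h1, h1.not_gt]
    · simp [flip, h, h1, h1.not_gt]
  · simp [flip, h]

/-- For different colours 𝐓 has no diagonal terms. For equal colours everything depends on the signs
of the indices a, b and on the order of a relative to b and -b; `hu` is needed only when a = ±b. -/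
theorem reflection {u c d : R} (hu : u * u = 1 + c * u)
    (w : X n × Fin (n + 1) → X n × Fin (n + 1) → M) (S T : Module.End R M)
    (hS : ∀ p q, S (w p q) = w (flip p) q + signCoeff d p • w p q)
    (hT : ∀ p q, T (w p q) = swapCoeff u p q • w q p + diagCoeff c p q • w p q)
    (p q : X n × Fin (n + 1)) : S (T (S (T (w p q)))) = T (S (T (S (w p q)))) := by
  simp only [hS, hT, map_add, map_smul, flip_flip]
  obtain ⟨⟨a, ha, ha'⟩, i⟩ := p
  obtain ⟨⟨b, hb, hb'⟩, j⟩ := q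
  simp only [flip, X.neg, swapCoeff, diagCoeff, signCoeff, Prod.mk.injEq, Subtype.mk.injEq]
  by_cases hij : i = j
  · subst hij
    have e2 : -a < -b ↔ b < a := by omega
    have e3 : b < -a ↔ a < -b := by omega
    have e4 : -a < b ↔ -b < a := by omega
    have e5 : -a < 0 ↔ ¬ a < 0 := by omega
    have e6 : -b < 0 ↔ ¬ b < 0 := by omega
    have e7 : b = a ↔ a = b := by omega
    have e8 : b = -a ↔ a = -b := by omega
    have e9 : -a = b ↔ a = -b := by omega
    have e10 : -b = a ↔ a = -b := by omega
    have e12 : -b = -a ↔ a = b := by omega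
    simp only [e2, e3, e4, e5, e6, e7, e8, e9, e10, e12, and_true, true_and]
    rcases lt_trichotomy a b with h1 | h1 | h1
    · have f1 : ¬ a = b := h1.ne
      have f2 : ¬ b < a := h1.not_gt
      rcases lt_trichotomy a (-b) with h2 | h2 | h2
      · have f3 : ¬ a = -b := h2.ne
        have f4 : ¬ -b < a := h2.not_gt
        have f5 : a < 0 := by omega
        simp only [h1, h2, f1, f2, f3, f4, f5, if_true, if_false, and_true, and_false, not_true]
        split_ifs <;> first | omega | module
      · have f5 : a < 0 := by omega
        have f6 : ¬ b < 0 := by omega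
        subst h2
        simp only [neg_neg, lt_irrefl, h1, f1, f2, f5, f6, if_true, if_false, and_true, and_false,
          not_true, not_false_iff]
        split_ifs <;> module
      · have f3 : ¬ a = -b := h2.ne'
        have f4 : ¬ a < -b := h2.not_gt
        have f5 : ¬ b < 0 := by omega
        simp only [h1, h2, f1, f2, f3, f4, f5, if_true, if_false, and_true, and_false,
          not_false_iff]
        split_ifs <;> first | omega | module
    · subst h1
      have f1 : ¬ a = -a := by omega
      simp only [lt_irrefl, f1, if_true, if_false]
      split_ifs <;> first
        | omega
        | match_scalars <;> first | ring1 | linear_combination d * hu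
    · have f1 : ¬ a = b := h1.ne'
      have f2 : ¬ a < b := h1.not_gt
      rcases lt_trichotomy a (-b) with h2 | h2 | h2
      · have f3 : ¬ a = -b := h2.ne
        have f4 : ¬ -b < a := h2.not_gt
        have f5 : b < 0 := by omega
        simp only [h1, h2, f1, f2, f3, f4, f5, if_true, if_false, and_true, and_false, not_true]
        split_ifs <;> first | omega | module
      · have f5 : ¬ a < 0 := by omega
        have f6 : b < 0 := by omega
        subst h2
        simp only [neg_neg, lt_irrefl, h1, f1, f2, f5, f6, if_true, if_false, and_true, and_false,
          not_true, not_false_iff]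
        split_ifs <;> match_scalars <;>
          first | ring1 | linear_combination d * hu | linear_combination -d * hu
      · have f3 : ¬ a = -b := h2.ne'
        have f4 : ¬ a < -b := h2.not_gt
        have f5 : ¬ a < 0 := by omega
        simp only [h1, h2, f1, f2, f3, f4, f5, if_true, if_false, and_true, and_false,
          not_false_iff]
        split_ifs <;> first | omega | module
  · simp only [hij, Ne.symm hij, false_and, and_false, if_false]
    module

end

/-! ### The tensor space as a model -/

section

variable {n : ℕ} [NeZero n] {R M : Type*} [CommRing R] [AddCommGroup M] [Module R M]

/-- The generators act on the vectors of a basis as they act on the pure tensors of basis vectors in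
the tensor power. -/
structure IsTensorAction (u c d : R) (β : Module.Basis (Fin n → X n × Fin (n + 1)) R M)
    (o : Gen n → Module.End R M) : Prop where
  B : ∀ x, o .B (β x) = β (Function.update x 0 (flip (x 0))) + signCoeff d (x 0) • β x
  T : ∀ i x, o (.T i) (β x) = swapCoeff u (x (lo i)) (x (hi i)) •
    β (x ∘ Equiv.swap (lo i) (hi i)) + diagCoeff c (x (lo i)) (x (hi i)) • β x
  E : ∀ i x, o (.E i) (β x) = (if (x (lo i)).2 = (x (hi i)).2 then (1 : R) else 0) • β x
  F : ∀ j x, o (.F j) (β x) = (if (x j).2 = 0 then (1 : R) else 0) • β x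

/-- A diagonal operator whose eigenvalues depend on the colours. -/
def diagOp (β : Module.Basis (Fin n → X n × Fin (n + 1)) R M) (χ : (Fin n → Fin (n + 1)) → R) :
    Module.End R M :=
  β.constr R fun x => χ (fun k => (x k).2) • β x

omit [NeZero n] in
theorem diagOp_apply (β : Module.Basis (Fin n → X n × Fin (n + 1)) R M)
    (χ : (Fin n → Fin (n + 1)) → R) (x : Fin n → X n × Fin (n + 1)) :
    diagOp β χ (β x) = χ (fun k => (x k).2) • β x := by
  rw [diagOp, Module.Basis.constr_basis]

omit [NeZero n] in
theorem diagOp_mul (β : Module.Basis (Fin n → X n × Fin (n + 1)) R M)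
    (χ ψ : (Fin n → Fin (n + 1)) → R) :
    diagOp β χ * diagOp β ψ = diagOp β (χ * ψ) := by
  refine β.ext fun x => ?_
  simp only [Module.End.mul_apply, diagOp_apply, map_smul, smul_smul, Pi.mul_apply]
  rw [mul_comm]

/-- The eigenvalue of `𝐄` on the factors `i` and `j`. -/
def tieChar (R : Type*) [CommRing R] (i j : Fin n) (r : Fin n → Fin (n + 1)) : R :=
  if r i = r j then 1 else 0

/-- The eigenvalue of `𝐅` on the factor `j`. -/
def zeroChar (R : Type*) [CommRing R] (j : Fin n) (r : Fin n → Fin (n + 1)) : R :=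
  if r j = 0 then 1 else 0

/-- Two neighbouring pairs of positions consist of three positions. -/
theorem Near.cases {n : ℕ} {i j : Fin (n - 1)} (h : Near i j) :
    (hi i = lo j ∧ lo i ≠ hi j) ∨ (hi j = lo i ∧ lo j ≠ hi i) := by
  rcases h with h | h
  · left
    simp [lo, hi, Fin.ext_iff]
    omega
  · right
    simp [lo, hi, Fin.ext_iff]
    omega

namespace IsTensorAction

variable {u c d : R} {β : Module.Basis (Fin n → X n × Fin (n + 1)) R M}
  {o : Gen n → Module.End R M} (H : IsTensorAction u c d β o)
include H

theorem E_eq (i : Fin (n - 1)) : o (.E i) = diagOp β (tieChar R (lo i) (hi i)) :=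
  β.ext fun x => by rw [H.E, diagOp_apply]; rfl

theorem F_eq (j : Fin n) : o (.F j) = diagOp β (zeroChar R j) :=
  β.ext fun x => by rw [H.F, diagOp_apply]; rfl

/-- The diagonal term of 𝐓 survives only between equal colours, and exchanging those does not affect
χ. -/
theorem T_mul_diagOp (i : Fin (n - 1)) (χ : (Fin n → Fin (n + 1)) → R) :
    o (.T i) * diagOp β (fun r => χ (r ∘ Equiv.swap (lo i) (hi i))) = diagOp β χ * o (.T i) := by
  refine β.ext fun x => ?_
  simp only [Module.End.mul_apply, diagOp_apply, H.T, map_smul, map_add, smul_add, smul_smul]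
  congr 1
  · congr 1
    exact mul_comm _ _
  · by_cases h : (x (lo i)).2 = (x (hi i)).2
    · rw [mul_comm]
      congr 3
      funext k
      simp only [Function.comp_apply, Equiv.swap_apply_def]
      split_ifs with h1 h2
      · rw [h1, h]
      · rw [h2, h]
      · rfl
    · rw [diagCoeff_of_ne c h, mul_zero, zero_mul]

/-- 𝐁 changes the sign of an index but never a colour. -/
theorem B_mul_diagOp (χ : (Fin n → Fin (n + 1)) → R) :
    o .B * diagOp β χ = diagOp β χ * o .B := by
  refine β.ext fun x => ?_
  simp only [Module.End.mul_apply, diagOp_apply, H.B, map_smul, map_add, smul_add, smul_smul]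
  congr 1
  · congr 2
    funext k
    rcases eq_or_ne k 0 with rfl | h
    · simp [flip]
    · simp [h]
  · rw [mul_comm]

theorem T_update (i : Fin (n - 1)) (x : Fin n → X n × Fin (n + 1)) (p q : X n × Fin (n + 1)) :
    o (.T i) (β (Function.update (Function.update x (lo i) p) (hi i) q)) =
      swapCoeff u p q • β (Function.update (Function.update x (lo i) q) (hi i) p) +
        diagCoeff c p q • β (Function.update (Function.update x (lo i) p) (hi i) q) := by
  have h : Function.update (Function.update x (lo i) p) (hi i) q ∘ Equiv.swap (lo i) (hi i) =
      Function.update (Function.update x (lo i) q) (hi i) p := by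
    rw [← update_swap]
    simp [lo_ne_hi i, Function.update_comm (lo_ne_hi i)]
  rw [H.T, h]
  simp [lo_ne_hi i]

theorem T_sq (hu : u * u = 1 + c * u) (i : Fin (n - 1)) :
    o (.T i) * o (.T i) = 1 + c • (o (.T i) * o (.E i)) := by
  refine β.ext fun x => ?_
  have hs : (x ∘ Equiv.swap (lo i) (hi i)) ∘ Equiv.swap (lo i) (hi i) = x := by
    funext k
    simp
  simp only [Module.End.mul_apply, LinearMap.add_apply, LinearMap.smul_apply, Module.End.one_apply,
    H.T, H.E, map_smul, map_add, hs, Function.comp_apply, Equiv.swap_apply_left,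
    Equiv.swap_apply_right]
  by_cases h : x (lo i) = x (hi i)
  · have hx : x ∘ Equiv.swap (lo i) (hi i) = x := by
      rw [← update_swap, ← h, Function.update_eq_self, h, Function.update_eq_self]
    simp only [hx, h, swapCoeff_self, diagCoeff_self, if_true]
    match_scalars
    linear_combination hu
  · simp only [swapCoeff_of_ne u h, swapCoeff_of_ne u (Ne.symm h)]
    have h1 := diagCoeff_add c h
    have h2 := diagCoeff_sq c (x (lo i)) (x (hi i))
    by_cases h3 : (x (lo i)).2 = (x (hi i)).2
    · simp only [h3, if_true] at h1 ⊢
      match_scalars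
      · linear_combination h2
      · linear_combination h1
    · simp only [h3, diagCoeff_of_ne c h3, diagCoeff_of_ne c (Ne.symm h3), if_false]
      module

theorem B_sq : o .B * o .B = 1 + d • (o .B * o (.F 0)) := by
  refine β.ext fun x => ?_
  simp only [Module.End.mul_apply, LinearMap.add_apply, LinearMap.smul_apply, Module.End.one_apply,
    H.B, H.F, map_smul, map_add, Function.update_self, Function.update_idem, flip_flip,
    Function.update_eq_self]
  have h1 := signCoeff_flip d (x 0)
  have h2 := signCoeff_sq d (x 0)
  by_cases h3 : (x 0).2 = 0
  · simp only [h3, if_true] at h1 ⊢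
    match_scalars
    · linear_combination h2
    · linear_combination h1
  · have h4 : ∀ p : X n × Fin (n + 1), p.2 ≠ 0 → signCoeff d p = 0 := fun p hp =>
      if_neg fun h => hp h.1
    simp only [h3, h4 _ h3, h4 (flip (x 0)) h3, if_false]
    module

theorem T_far (i j : Fin (n - 1)) (h : Far i j) : o (.T i) * o (.T j) = o (.T j) * o (.T i) := by
  have e1 : lo i ≠ lo j := by simp only [Far] at h; simp [lo, Fin.ext_iff]; omega
  have e2 : lo i ≠ hi j := by simp only [Far] at h; simp [lo, hi, Fin.ext_iff]; omega
  have e3 : hi i ≠ lo j := by simp only [Far] at h; simp [lo, hi, Fin.ext_iff]; omega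
  have e4 : hi i ≠ hi j := by simp only [Far] at h; simp [hi, Fin.ext_iff]; omega
  have w1 := Equiv.swap_apply_of_ne_of_ne e1 e2
  have w2 := Equiv.swap_apply_of_ne_of_ne e3 e4
  have w3 := Equiv.swap_apply_of_ne_of_ne e1.symm e3.symm
  have w4 := Equiv.swap_apply_of_ne_of_ne e2.symm e4.symm
  refine β.ext fun x => ?_
  have hx : (x ∘ Equiv.swap (lo j) (hi j)) ∘ Equiv.swap (lo i) (hi i) =
      (x ∘ Equiv.swap (lo i) (hi i)) ∘ Equiv.swap (lo j) (hi j) := by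
    funext k
    simp only [Function.comp_apply]
    congr 1
    by_cases k1 : k = lo i
    · subst k1; simp [w1, w2]
    by_cases k2 : k = hi i
    · subst k2; simp [w1, w2]
    by_cases k3 : k = lo j
    · subst k3; simp [w3, w4]
    by_cases k4 : k = hi j
    · subst k4; simp [w3, w4]
    simp [Equiv.swap_apply_of_ne_of_ne, k1, k2, k3, k4]
  simp only [Module.End.mul_apply, H.T, map_smul, map_add, Function.comp_apply, w1, w2, w3, w4, hx]
  module

theorem T_braid (hu : u * u = 1 + c * u) (i j : Fin (n - 1)) (h : i.val + 1 = j.val) :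
    o (.T i) * (o (.T j) * o (.T i)) = o (.T j) * (o (.T i) * o (.T j)) := by
  have e1 : lo j = hi i := by simp [lo, hi, Fin.ext_iff]; omega
  have e3 : lo i ≠ hi j := by simp [lo, hi, Fin.ext_iff]; omega
  have e4 : hi i ≠ hi j := by simp [hi, Fin.ext_iff]; omega
  refine β.ext fun x => ?_
  simp only [Module.End.mul_apply]
  -- Freezing all other positions reduces the relation to three tensor factors.
  let w : X n × Fin (n + 1) → X n × Fin (n + 1) → X n × Fin (n + 1) → M := fun p q r =>
    β (Function.update (Function.update (Function.update x (lo i) p) (hi i) q) (hi j) r)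
  have hx : β x = w (x (lo i)) (x (hi i)) (x (hi j)) := by
    simp only [w]
    congr 1
    simp
  rw [hx]
  refine yangBaxter hu w _ _ (fun p q r => ?_) (fun p q r => ?_) _ _ _
  · have := H.T_update i (Function.update x (hi j) r) p q
    rwa [update_off i x (hi j) e3.symm e4.symm, update_off i x (hi j) e3.symm e4.symm] at this
  · have := H.T_update j (Function.update x (lo i) p) q r
    rwa [e1] at this

theorem BT_braid (hu : u * u = 1 + c * u) (i : Fin (n - 1)) (h : i.val = 0) :
    o .B * (o (.T i) * (o .B * o (.T i))) = o (.T i) * (o .B * (o (.T i) * o .B)) := by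
  have e1 : lo i = 0 := by simp [lo, Fin.ext_iff]; omega
  have e2 : (0 : Fin n) ≠ hi i := by simp [hi, Fin.ext_iff]
  refine β.ext fun x => ?_
  simp only [Module.End.mul_apply]
  let w : X n × Fin (n + 1) → X n × Fin (n + 1) → M := fun p q =>
    β (Function.update (Function.update x (lo i) p) (hi i) q)
  have hx : β x = w (x (lo i)) (x (hi i)) := by
    simp [w]
  rw [hx]
  refine reflection (d := d) hu w _ _ (fun p q => ?_) (fun p q => H.T_update i x p q) _ _
  simp only [w, e1, H.B]
  simp [e2, Function.update_comm e2]

theorem BT_comm (i : Fin (n - 1)) (h : 0 < i.val) : o (.T i) * o .B = o .B * o (.T i) := by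
  have e1 : (0 : Fin n) ≠ lo i := by simp [lo, Fin.ext_iff]; omega
  have e2 : (0 : Fin n) ≠ hi i := by simp [hi, Fin.ext_iff]
  refine β.ext fun x => ?_
  have hx : Function.update x 0 (flip (x 0)) ∘ Equiv.swap (lo i) (hi i) =
      Function.update (x ∘ Equiv.swap (lo i) (hi i)) 0 (flip (x 0)) := by
    funext k
    by_cases k1 : k = 0
    · subst k1
      simp [Equiv.swap_apply_of_ne_of_ne e1 e2]
    have : Equiv.swap (lo i) (hi i) k ≠ 0 := by
      rw [Equiv.swap_apply_def]
      split_ifs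
      exacts [e2.symm, e1.symm, k1]
    simp [k1, this]
  simp only [Module.End.mul_apply, H.T, H.B, map_smul, map_add, hx, Function.comp_apply,
    Equiv.swap_apply_of_ne_of_ne e1 e2, Function.update_of_ne e1.symm,
    Function.update_of_ne e2.symm]
  module

theorem E_mul_T (i : Fin (n - 1)) : o (.T i) * o (.E i) = o (.E i) * o (.T i) := by
  rw [H.E_eq, ← H.T_mul_diagOp]
  congr 2
  funext r
  simp [tieChar, eq_comm]

theorem T_mul_E (i j : Fin (n - 1)) (h : Far i j) : o (.T j) * o (.E i) = o (.E i) * o (.T j) := by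
  have e1 : lo i ≠ lo j := by simp only [Far] at h; simp [lo, Fin.ext_iff]; omega
  have e2 : lo i ≠ hi j := by simp only [Far] at h; simp [lo, hi, Fin.ext_iff]; omega
  have e3 : hi i ≠ lo j := by simp only [Far] at h; simp [lo, hi, Fin.ext_iff]; omega
  have e4 : hi i ≠ hi j := by simp only [Far] at h; simp [hi, Fin.ext_iff]; omega
  rw [H.E_eq, ← H.T_mul_diagOp]
  congr 2
  funext r
  simp [tieChar, Equiv.swap_apply_of_ne_of_ne, e1, e2, e3, e4]

theorem T_mul_F (j : Fin n) (i : Fin (n - 1)) :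
    o (.T i) * o (.F j) = o (.F (Equiv.swap (lo i) (hi i) j)) * o (.T i) := by
  rw [H.F_eq, H.F_eq, ← H.T_mul_diagOp]
  congr 2
  funext r
  simp [zeroChar]

theorem T_mul_EE (i j : Fin (n - 1)) (h : Near i j) :
    o (.T i) * (o (.E j) * o (.E i)) = o (.E j) * (o (.E i) * o (.T i)) := by
  rw [← mul_assoc (o (.E j)), H.E_eq, H.E_eq, diagOp_mul, ← H.T_mul_diagOp]
  congr 2
  funext r
  have h1 := lo_ne_hi i
  have h2 := lo_ne_hi j
  rcases h.cases with ⟨e1, e2⟩ | ⟨e1, e2⟩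
  · rw [← e1] at h2
    simp only [tieChar, Pi.mul_apply, Function.comp_apply, ← e1, Equiv.swap_apply_left,
      Equiv.swap_apply_right, Equiv.swap_apply_of_ne_of_ne e2.symm h2.symm]
    split_ifs <;> grind
  · rw [e1] at h2
    simp only [tieChar, Pi.mul_apply, Function.comp_apply, e1, Equiv.swap_apply_left,
      Equiv.swap_apply_right, Equiv.swap_apply_of_ne_of_ne h2 e2]
    split_ifs <;> grind

theorem E_mul_T_mul_E (i j : Fin (n - 1)) (h : Near i j) :
    o (.E j) * (o (.E i) * o (.T i)) = o (.E j) * (o (.T i) * o (.E j)) := by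
  rw [← mul_assoc, ← mul_assoc, H.E_eq, H.E_eq, diagOp_mul, ← H.T_mul_diagOp, ← H.T_mul_diagOp,
    mul_assoc, diagOp_mul]
  congr 2
  funext r
  have h1 := lo_ne_hi i
  have h2 := lo_ne_hi j
  rcases h.cases with ⟨e1, e2⟩ | ⟨e1, e2⟩
  · rw [← e1] at h2
    simp only [tieChar, Pi.mul_apply, Function.comp_apply, ← e1, Equiv.swap_apply_left,
      Equiv.swap_apply_right, Equiv.swap_apply_of_ne_of_ne e2.symm h2.symm]
    by_cases h3 : r (lo i) = r (hi j) <;> simp [h3]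
  · rw [e1] at h2
    simp only [tieChar, Pi.mul_apply, Function.comp_apply, e1, Equiv.swap_apply_left,
      Equiv.swap_apply_right, Equiv.swap_apply_of_ne_of_ne h2 e2]
    by_cases h3 : r (lo j) = r (hi i) <;> simp [h3]

theorem TT_mul_E (i j : Fin (n - 1)) (h : Near i j) :
    o (.T i) * (o (.T j) * o (.E i)) = o (.E j) * (o (.T i) * o (.T j)) := by
  rw [← mul_assoc (o (.E j)), H.E_eq, H.E_eq, ← H.T_mul_diagOp, mul_assoc, ← H.T_mul_diagOp]
  congr 3
  funext r
  have h1 := lo_ne_hi i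
  have h2 := lo_ne_hi j
  rcases h.cases with ⟨e1, e2⟩ | ⟨e1, e2⟩
  · rw [← e1] at h2
    simp only [tieChar, Function.comp_apply, ← e1, Equiv.swap_apply_right,
      Equiv.swap_apply_of_ne_of_ne h1 e2, Equiv.swap_apply_of_ne_of_ne e2.symm h2.symm]
  · rw [e1] at h2
    simp only [tieChar, Function.comp_apply, e1, Equiv.swap_apply_left,
      Equiv.swap_apply_of_ne_of_ne h2 e2, Equiv.swap_apply_of_ne_of_ne e2.symm h1.symm]

theorem E_mul_F_lo (i : Fin (n - 1)) :
    o (.F (lo i)) * o (.E i) = o (.F (hi i)) * o (.F (lo i)) := by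
  rw [H.E_eq, H.F_eq, H.F_eq, diagOp_mul, diagOp_mul]
  congr 1
  funext r
  by_cases h1 : r (lo i) = 0 <;> simp [zeroChar, tieChar, h1, eq_comm]

theorem E_mul_F_hi (i : Fin (n - 1)) :
    o (.F (hi i)) * o (.F (lo i)) = o (.F (hi i)) * o (.E i) := by
  rw [H.E_eq, H.F_eq, H.F_eq, diagOp_mul, diagOp_mul]
  congr 1
  funext r
  by_cases h1 : r (hi i) = 0 <;> simp [zeroChar, tieChar, h1]

theorem E_mul_E (i j : Fin (n - 1)) : o (.E i) * o (.E j) = o (.E j) * o (.E i) := by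
  rw [H.E_eq, H.E_eq, diagOp_mul, diagOp_mul, mul_comm]

theorem F_mul_E (j : Fin n) (i : Fin (n - 1)) : o (.F j) * o (.E i) = o (.E i) * o (.F j) := by
  rw [H.E_eq, H.F_eq, diagOp_mul, diagOp_mul, mul_comm]

theorem B_mul_E (i : Fin (n - 1)) : o .B * o (.E i) = o (.E i) * o .B := by
  rw [H.E_eq, H.B_mul_diagOp]

theorem B_mul_F (j : Fin n) : o .B * o (.F j) = o (.F j) * o .B := by
  rw [H.F_eq, H.B_mul_diagOp]

theorem E_mul_self (i : Fin (n - 1)) : o (.E i) * o (.E i) = o (.E i) := by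
  rw [H.E_eq, diagOp_mul]
  congr 1
  funext r
  simp only [tieChar, Pi.mul_apply]
  split_ifs <;> simp

theorem F_mul_self (j : Fin n) : o (.F j) * o (.F j) = o (.F j) := by
  rw [H.F_eq, diagOp_mul]
  congr 1
  funext r
  simp only [zeroChar, Pi.mul_apply]
  split_ifs <;> simp

/-- Composition from left to right is multiplication in the opposite algebra, so the operator
identities used here have their products reversed. -/
theorem isModel (hu : u * u = 1 + c * u) : IsModel c d fun g => MulOpposite.op (o g) where
  tt_far i j h := congrArg MulOpposite.op (H.T_far i j h).symm
  tt_braid i j h := congrArg MulOpposite.op (H.T_braid hu i j h)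
  tt_same i := congrArg MulOpposite.op (H.T_sq hu i)
  ee_same i := congrArg MulOpposite.op (H.E_mul_self i)
  ee_comm i j := congrArg MulOpposite.op (H.E_mul_E j i)
  et_same i := congrArg MulOpposite.op (H.E_mul_T i)
  et_far i j h := congrArg MulOpposite.op (H.T_mul_E i j h)
  eet_left i j h := congrArg MulOpposite.op (H.T_mul_EE i j h)
  eet_right i j h := congrArg MulOpposite.op (H.E_mul_T_mul_E i j h)
  ett i j h := congrArg MulOpposite.op (H.TT_mul_E i j h)
  bt_braid i h := congrArg MulOpposite.op (H.BT_braid hu i h).symm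
  bt_comm i h := congrArg MulOpposite.op (H.BT_comm i h)
  bb := congrArg MulOpposite.op H.B_sq
  be i := congrArg MulOpposite.op (H.B_mul_E i).symm
  ff j := congrArg MulOpposite.op (H.F_mul_self j)
  bf j := congrArg MulOpposite.op (H.B_mul_F j).symm
  fe j i := congrArg MulOpposite.op (H.F_mul_E j i).symm
  ft j i := congrArg MulOpposite.op (H.T_mul_F j i)
  ef_lo i := congrArg MulOpposite.op (H.E_mul_F_lo i)
  ef_hi i := congrArg MulOpposite.op (H.E_mul_F_hi i)

end IsTensorAction

end

/-! ### The representation -/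

section

variable {n : ℕ} [NeZero n] {R M : Type*} [Field R] [AddCommGroup M] [Module R M]

/-- In the test vectors the colour belongs to the label, not to the position, so it travels with the
entry. Undoing a descent starts from a positive first entry or from increasing neighbours, where the
diagonal coefficient is zero, and so yields a single basis tensor. -/
theorem IsTensorAction.injective {A : Type*} [Ring A] [Algebra R A] {u c d : R} {φ : Gen n → A}
    (H : IsModel c d φ) (hgen : Algebra.adjoin R (Set.range φ) = ⊤)
    {β : Module.Basis (Fin n → X n × Fin (n + 1)) R M} {o : Gen n → Module.End R M}
    (Ho : IsTensorAction u c d β o) (Ψ : A →ₐ[R] (Module.End R M)ᵐᵒᵖ)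
    (hΨ : ∀ g, Ψ (φ g) = MulOpposite.op (o g)) : Function.Injective Ψ := by
  refine H.injective_of_vec hgen Ψ (fun f r => β fun k => (f k, r (f k).label)) ?_ ?_ ?_ ?_
  · intro r
    have hinj : Function.Injective fun (f : Fin n → X n) k => (f k, r (f k).label) := by
      intro f f' h
      funext k
      exact congrArg Prod.fst (congrFun h k)
    exact β.linearIndependent.comp _ hinj
  · intro s f r hs
    cases s with
    | none =>
      have hneg : (move none f 0).1 = -(f 0).1 := by simp [move]
      simp only [Descent] at hs
      have h0 : signCoeff d (move none f 0, r (move none f 0).label) = 0 :=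
        if_neg fun h => by
          have := h.2
          dsimp only at this
          omega
      rw [cox, hΨ, MulOpposite.unop_op, Ho.B, h0, zero_smul, add_zero]
      congr 1
      funext k
      rcases eq_or_ne k 0 with rfl | hk
      · simp [move, flip]
      · simp [move, hk]
    | some i =>
      simp only [Descent] at hs
      have h1 : move (some i) f (lo i) = f (hi i) := by simp [move]
      have h2 : move (some i) f (hi i) = f (lo i) := by simp [move]
      have h3 : f (hi i) ≠ f (lo i) := fun h => by rw [h] at hs; exact lt_irrefl _ hs
      have h4 : diagCoeff c (f (hi i), r (f (hi i)).label) (f (lo i), r (f (lo i)).label) = 0 :=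
        if_neg fun h => h.2.not_gt hs
      rw [cox, hΨ, MulOpposite.unop_op, Ho.T, h1, h2, h4,
        swapCoeff_of_ne u fun h => h3 (congrArg Prod.fst h), zero_smul, add_zero, one_smul]
      congr 1
      funext k
      simp [move]
  · intro i f r
    rw [hΨ, MulOpposite.unop_op, Ho.E]
  · intro j f r
    rw [hΨ, MulOpposite.unop_op, Ho.F]

theorem isTensorAction_opGen {V : Type*} [AddCommGroup V] [Module K V]
    (b : Module.Basis (X n × Fin (n + 1)) K V) :
    IsTensorAction uu (uu - uu⁻¹) (vv - vv⁻¹) (Basis.piTensorProduct fun _ : Fin n => b)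
      (opGen b) where
  B x := by simp only [piTensorProduct_eq_basisTensor, opGen_B]
  T i x := by simp only [piTensorProduct_eq_basisTensor, opGen_T]
  E i x := by simp only [piTensorProduct_eq_basisTensor, opGen_E]
  F j x := by simp only [piTensorProduct_eq_basisTensor, opGen_F]

/-- The only condition on the parameters that the operators require; `v - v⁻¹` could be any scalar.
-/
theorem uu_mul_self : uu * uu = 1 + (uu - uu⁻¹) * uu := by
  have : uu ≠ 0 := by
    rw [uu, ne_eq, IsFractionRing.to_map_eq_zero_iff]
    exact MvPolynomial.X_ne_zero 0
  rw [sub_mul, inv_mul_cancel₀ this, add_sub_cancel]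

/-! ### The algebra given by generators and relations -/

theorem gen_rel {x y : Free n} (h : Rel n x y) :
    RingQuot.mkAlgHom K (Rel n) x = RingQuot.mkAlgHom K (Rel n) y :=
  RingQuot.mkAlgHom_rel K h

variable (n) in
/-- The ring structure of the bt-algebra. -/
abbrev algRing : Ring (Alg n) := Algebra.semiringToRing K

theorem lift_rel {A : Type*} [Ring A] [Algebra K A] {φ : Gen n → A}
    (H : IsModel (uu - uu⁻¹) (vv - vv⁻¹) φ) {x y : Free n} (h : Rel n x y) :
    FreeAlgebra.lift K φ x = FreeAlgebra.lift K φ y := by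
  cases h <;> simp only [map_mul, map_add, map_one, map_smul, FreeAlgebra.lift_ι_apply]
  case T_comm i j h => exact H.tt_far i j h
  case T_braid i j h => exact H.tt_braid i j h
  case T_quad i => exact H.tt_same i
  case E_idem i => exact H.ee_same i
  case E_comm i j => exact H.ee_comm i j
  case ET_same i => exact H.et_same i
  case ET_far i j h => exact H.et_far i j h
  case EET_left i j h => exact H.eet_left i j h
  case EET_right i j h => exact H.eet_right i j h
  case ETT i j h => exact H.ett i j h
  case BT_braid i h => exact H.bt_braid i h
  case BT_comm i h => exact H.bt_comm i h
  case B_quad => exact H.bb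
  case BE_comm i => exact H.be i
  case F_idem j => exact H.ff j
  case BF_comm j => exact H.bf j
  case FE_comm j i => exact H.fe j i
  case FT j i => exact H.ft j i
  case EF_lo i => exact H.ef_lo i
  case EF_hi i => exact H.ef_hi i

theorem isModel_gen :
    letI := algRing n
    IsModel (uu - uu⁻¹) (vv - vv⁻¹) (gen (n := n)) := by
  let _ := algRing n
  have key : ∀ {x y : Free n}, Rel n x y → FreeAlgebra.lift K gen x = FreeAlgebra.lift K gen y := by
    intro x y h
    have h1 : FreeAlgebra.lift K (gen (n := n)) = RingQuot.mkAlgHom K (Rel n) :=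
      FreeAlgebra.hom_ext (funext fun g => FreeAlgebra.lift_ι_apply _ _)
    rw [h1]
    exact gen_rel h
  constructor
  case tt_far => intro i j h; simpa using key (.T_comm i j h)
  case tt_braid => intro i j h; simpa using key (.T_braid i j h)
  case tt_same => intro i; simpa using key (.T_quad i)
  case ee_same => intro i; simpa using key (.E_idem i)
  case ee_comm => intro i j; simpa using key (.E_comm i j)
  case et_same => intro i; simpa using key (.ET_same i)
  case et_far => intro i j h; simpa using key (.ET_far i j h)
  case eet_left => intro i j h; simpa using key (.EET_left i j h)
  case eet_right => intro i j h; simpa using key (.EET_right i j h)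
  case ett => intro i j h; simpa using key (.ETT i j h)
  case bt_braid => intro i h; simpa using key (.BT_braid i h)
  case bt_comm => intro i h; simpa using key (.BT_comm i h)
  case bb => simpa using key .B_quad
  case be => intro i; simpa using key (.BE_comm i)
  case ff => intro j; simpa using key (.F_idem j)
  case bf => intro j; simpa using key (.BF_comm j)
  case fe => intro j i; simpa using key (.FE_comm j i)
  case ft => intro j i; simpa using key (.FT j i)
  case ef_lo => intro i; simpa using key (.EF_lo i)
  case ef_hi => intro i; simpa using key (.EF_hi i)

theorem adjoin_range_gen : Algebra.adjoin K (Set.range (gen (n := n))) = ⊤ := by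
  have h1 : Set.range (gen (n := n)) =
      RingQuot.mkAlgHom K (Rel n) '' Set.range (FreeAlgebra.ι K) := by
    rw [← Set.range_comp]
    rfl
  rw [h1, ← AlgHom.map_adjoin, FreeAlgebra.adjoin_range_ι, Algebra.map_top, AlgHom.range_eq_top]
  exact RingQuot.mkAlgHom_surjective K (Rel n)

end

end BTB

end

theorem mainTheorem5 (n : ℕ) [NeZero n] {V : Type*} [AddCommGroup V] [Module BTB.K V]
    (b : Module.Basis (BTB.X n × Fin (n + 1)) BTB.K V) :
    ∃ Φ : BTB.Alg n →ₐ[BTB.K] (Module.End BTB.K (BTB.Pow V n))ᵐᵒᵖ,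
      (∀ g : BTB.Gen n, Φ (BTB.gen g) = MulOpposite.op (BTB.opGen b g)) ∧
        Function.Injective Φ := by
  have h := BTB.isTensorAction_opGen b
  let Φ : BTB.Alg n →ₐ[BTB.K] (Module.End BTB.K (BTB.Pow V n))ᵐᵒᵖ :=
    RingQuot.liftAlgHom BTB.K ⟨FreeAlgebra.lift BTB.K fun g => MulOpposite.op (BTB.opGen b g),
      fun _ _ hr => BTB.lift_rel (h.isModel BTB.uu_mul_self) hr⟩
  have hΦ : ∀ g : BTB.Gen n, Φ (BTB.gen g) = MulOpposite.op (BTB.opGen b g) := fun g => by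
    rw [BTB.gen, RingQuot.liftAlgHom_mkAlgHom_apply, FreeAlgebra.lift_ι_apply]
  refine ⟨Φ, hΦ, ?_⟩
  -- This ring structure extends the semiring structure of the quotient, so `Φ` remains an algebra
  -- map for it.
  let _ := BTB.algRing n
  exact h.injective BTB.isModel_gen BTB.adjoin_range_gen Φ hΦ
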